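/- **DRC-restriction semigroups.** A *DRC-restriction semigroup* is a non-empty set $S$ with an associative product and two unary operations ${}^+,{}^*$ such that for all $x,y\in S$ $$x^+x=x,\quad (xy)^+=(xy^+)^+,\quad (xy)^+=x^+(xy)^+x^+,\quad x^{++}=x^+,\quad x^{+*}=x^+,\quad x(yx)^*=(yx^+)^*x,$$ $$xx^*=x,\quad (xy)^*=(x^*y)^*,\quad (xy)^*=y^*(xy)^*y^*,\quad x^{**}=x^*,\quad x^{*+}=x^*,\quad (xy)^+x=x(x^*y)^+.$$ A *(2,1,1)-homomorphism* is a map preserving the product, ${}^+$ and ${}^*$. Put $P(S)=\{x^+\mid x\in S\}=\{x^*\mid x\in S\}$. **Strong projection algebras.** A *strong projection algebra* is a non-empty set $P$ with binary operations $\times,\star$ such that for all $e,f,g\in P$: $e\times e=e$; $(e\times f)\times e=e\times f$; $e\times(f\times g)=(e\times f)\times(f\times g)$; $(e\times f)\times g=(e\times f)\times(e\times g)$; $e\star e=e$; $f\star e=e\star(f\star e)$; $(g\star f)\star e=(g\star f)\star(f\star e)$; $g\star(f\star e)=(g\star e)\star(f\star e)$; $(e\star(f\times g))\star g=(e\star f)\star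 g$; $g\times((g\star f)\times e)=g\times(f\times e)$; $(e\times f)\star e=e\times f$; $f\times(e\star f)=e\star f$; $e\times(((e\times f)\times g)\star f)=(e\times f)\times g$; $(f\times(g\star(f\star e)))\star e=g\star(f\star e)$. Write $e\le_P f$ if $e=f\times e$, and $p\,\mathcal F_P\,q$ if $p\times q=p$ and $p\star q=q$. A *$P$-path* is a tuple $\mathfrak p=(p_1,\dots,p_k)$, $k\ge 1$, of elements of $P$ with $p_1\mathcal F_P p_2\mathcal F_P\cdots\mathcal F_P p_k$; put $d(\mathfrak p)=p_1$, $r(\mathfrak p)=p_k$ and, if $p_k=q_1$, $(p_1,\dots,p_k)\circ(q_1,\dots,q_l)=(p_1,\dots,p_k,q_2,\dots,q_l)$. Let $\mathscr P(P)$ be the set of $P$-paths. Write $\mathfrak p\le_{\mathscr P}\mathfrak q=(q_1,\dots,q_k)$ if $\mathfrak p=(r_1,\dots,r_k)$ with $r_1\le_P q_1$ and $r_i=r_{i-1}\star q_i$ for $2\le i\le k$. **Chain projection ordered categories.** Consider a small category given as a non-empty set $C$ (of arrows) with maps $d,r:C\to C$ and a partial product $\circ$, where $a\circ b$ is defined iff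 $r(a)=d(b)$, and then $d(a\circ b)=d(a)$, $r(a\circ b)=r(b)$; the product is associative when defined, and $d(a)\circ a$, $a\circ r(a)$ are defined and equal to $a$. Its set of objects is $P_C=\{d(a)\mid a\in C\}=\{r(a)\mid a\in C\}$. It is an *ordered category* with respect to a partial order $\le$ on $C$ if: $a\le b$ implies $d(a)\le d(b)$ and $r(a)\le r(b)$; if $a\le b$, $c\le e$ and $a\circ c$, $b\circ e$ are defined, then $a\circ c\le b\circ e$; for $p\in P_C$ with $p\le d(a)$ there is a unique ${}_p{\downharpoonleft}a\le a$ with $d({}_p{\downharpoonleft}a)=p$; for $q\in P_C$ with $q\le r(a)$ there is a unique $a{\downharpoonright}_q\le a$ with $r(a{\downharpoonright}_q)=q$. A *chain projection ordered category* $(C,\circ,d,r,\le,P_C,\times,\star,\varepsilon)$ is an ordered category together with binary operations $\times,\star$ on $P_C$ making it a strong projection algebra whose order $\le_{P_C}$ is the restriction of $\le$ to $P_C$, and a map $\varepsilon:\mathscr P(P_C)\to C$, subject to the following conditions. * Put $x\Theta_a=r({}_{x\star d(a)}{\downharpoonleft}a)$ and $x\Delta_a=d(a{\downharpoonright}_{r(a)\times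 x})$ for $a\in C$, $x\in P_C$. For all $a\in C$ and $p,x\in P_C$: $(p\Theta_a)\times x=(p\times(x\Delta_a))\Theta_a$ and $x\star(p\Delta_a)=((x\Theta_a)\star p)\Delta_a$. * $\varepsilon$ is an *evaluation map*: $\varepsilon(p)=\varepsilon(p,p)=p$ for $p\in P_C$; $d(\varepsilon(\mathfrak p))=d(\mathfrak p)$ and $r(\varepsilon(\mathfrak p))=r(\mathfrak p)$; $\varepsilon(\mathfrak p\circ\mathfrak q)=\varepsilon(\mathfrak p)\circ\varepsilon(\mathfrak q)$ whenever $\mathfrak p\circ\mathfrak q$ is defined; $\mathfrak p\le_{\mathscr P}\mathfrak q$ implies $\varepsilon(\mathfrak p)\le\varepsilon(\mathfrak q)$. * If $b\in C$ and $e,f\in P_C$ satisfy $f=(e\Theta_b)\star f$ and $e=e\times(f\Delta_b)$, then, with $e_1=e\star d(b)$, $f_1=e\Theta_b$, $e_2=f\Delta_b$, $f_2=r(b)\times f$ (all of the following being defined), $$\varepsilon(e,e_1)\circ{}_{e_1}{\downharpoonleft}b\circ\varepsilon(f_1,f)=\varepsilon(e,e_2)\circ b{\downharpoonright}_{f_2}\circ\varepsilon(f_2,f).$$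 A *chain projection ordered functor* $\phi:C_1\to C_2$ is a map that commutes with $d$ and $r$, preserves all products $a\circ b$ that are defined, preserves $\le$, restricts to a homomorphism for $\times$ and $\star$ from $P_{C_1}$ to $P_{C_2}$, and satisfies $\varepsilon_1(p_1,\dots,p_k)\phi=\varepsilon_2(p_1\phi,\dots,p_k\phi)$ for every path $(p_1,\dots,p_k)\in\mathscr P(P_{C_1})$. **Theorem.** The category of DRC-restriction semigroups with (2,1,1)-homomorphisms is isomorphic to the category of chain projection ordered categories with chain projection ordered functors. More precisely: 1. For a DRC-restriction semigroup $S$, let $\mathbf C(S)$ be the set $S$ with $d(a)=a^+$, $r(a)=a^*$; $a\circ b=ab$, defined iff $a^*=b^+$; $a\le b$ iff $a=a^+b$ and $b^+a^+b^+=a^+$; $e\times f=(ef)^+$ and $e\star f=(ef)^*$ for $e,f\in P(S)$; $\varepsilon(p_1,\dots,p_k)=p_1\cdots p_k$. Then $\mathbf C(S)$ is a chain projection ordered category, and every (2,1,1)-homomorphism $S\to T$ is a chain projection ordered functor $\mathbf C(S)\to\mathbf C(T)$. 2. For a chain projection ordered category $C$, let $\mathbf S(C)$ be the set $C$ with $a^+=d(a)$,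 $a^*=r(a)$ and $$a\bullet b=a{\downharpoonright}_{r(a)\times d(b)}\circ\varepsilon\bigl(r(a)\times d(b),\,r(a)\star d(b)\bigr)\circ{}_{r(a)\star d(b)}{\downharpoonleft}b .$$ Then $\mathbf S(C)$ is a DRC-restriction semigroup, and every chain projection ordered functor $C_1\to C_2$ is a (2,1,1)-homomorphism $\mathbf S(C_1)\to\mathbf S(C_2)$. 3. The functors $\mathbf C$ and $\mathbf S$ so obtained, which leave the underlying sets and maps unchanged, are mutually inverse: $\mathbf S(\mathbf C(S))=S$ and $\mathbf C(\mathbf S(C))=C$ for all $S$ and $C$. -/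

import Mathlib

open CategoryTheory

universe u v

namespace DRC

/-! ### DRC-restriction semigroups -/

/-- A carrier with a binary operation and two unary operations `x ↦ x⁺` and `x ↦ x*`. -/
class BiUnary (S : Type u) extends Mul S where
  plus : S → S
  ast : S → S

open BiUnary

/-- A DRC semigroup: an associative bi-unary algebra satisfying the DRC conditions. -/
structure IsDRCSemigroup (S : Type u) [BiUnary S] : Prop where
  mul_assoc : ∀ x y z : S, (x * y) * z = x * (y * z)
  plus_mul : ∀ x : S, plus x * x = x
  mul_ast : ∀ x : S, x * ast x = x
  plus_congr : ∀ x y : S, plus (x * y) = plus (x * plus y)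
  ast_congr : ∀ x y : S, ast (x * y) = ast (ast x * y)
  plus_reduced : ∀ x y : S, plus (x * y) = plus x * plus (x * y) * plus x
  ast_reduced : ∀ x y : S, ast (x * y) = ast y * ast (x * y) * ast y
  plus_plus : ∀ x : S, plus (plus x) = plus x
  ast_ast : ∀ x : S, ast (ast x) = ast x
  ast_plus : ∀ x : S, ast (plus x) = plus x
  plus_ast : ∀ x : S, plus (ast x) = ast x

/-- A DRC-restriction semigroup: a DRC semigroup satisfying the DRC-ample conditions. -/
structure IsDRCRestriction (S : Type u) [BiUnary S] : Prop extends IsDRCSemigroup S where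
  ample_left : ∀ x y : S, x * ast (y * x) = ast (y * plus x) * x
  ample_right : ∀ x y : S, plus (x * y) * x = x * plus (ast x * y)

/-- A (2,1,1)-homomorphism. -/
structure IsBiUnaryHom {S : Type u} {T : Type v} [BiUnary S] [BiUnary T] (φ : S → T) : Prop where
  map_mul : ∀ x y, φ (x * y) = φ x * φ y
  map_plus : ∀ x, φ (plus x) = plus (φ x)
  map_ast : ∀ x, φ (ast x) = ast (φ x)

/-- The objects of the category of (non-empty) DRC-restriction semigroups. -/
structure DRS : Type (u + 1) where
  carrier : Type u
  nonempty : Nonempty carrier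
  op : BiUnary carrier
  isDRCRestriction : @IsDRCRestriction carrier op

namespace DRS

instance (S : DRS.{u}) : BiUnary S.carrier := S.op

@[ext]
structure Hom (S T : DRS.{u}) : Type u where
  toFun : S.carrier → T.carrier
  isHom : IsBiUnaryHom toFun

instance : Category DRS.{u} where
  Hom S T := Hom S T
  id S := ⟨fun x => x, ⟨fun _ _ => rfl, fun _ => rfl, fun _ => rfl⟩⟩
  comp f g := ⟨fun x => g.toFun (f.toFun x),
    ⟨fun x y => by rw [f.isHom.map_mul, g.isHom.map_mul],
     fun x => by rw [f.isHom.map_plus, g.isHom.map_plus],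
     fun x => by rw [f.isHom.map_ast, g.isHom.map_ast]⟩⟩

end DRS

/-! ### Strong two-sided projection algebras and their paths -/

/-- A strong two-sided projection algebra `(P, ×, ⋆)`. -/
structure IsStrongProjAlg {P : Type u} (times star : P → P → P) : Prop where
  L1 : ∀ e, times e e = e
  L2 : ∀ e f, times (times e f) e = times e f
  L3 : ∀ e f g, times e (times f g) = times (times e f) (times f g)
  L4 : ∀ e f g, times (times e f) g = times (times e f) (times e g)
  R1 : ∀ e, star e e = e
  R2 : ∀ e f, star f e = star e (star f e)
  R3 : ∀ e f g, star (star g f) e = star (star g f) (star f e)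
  R4 : ∀ e f g, star g (star f e) = star (star g e) (star f e)
  P3_star : ∀ e f g, star (star e (times f g)) g = star (star e f) g
  P3_times : ∀ e f g, times g (times (star g f) e) = times g (times f e)
  P4_times : ∀ e f, star (times e f) e = times e f
  P4_star : ∀ e f, times f (star e f) = star e f
  SP1 : ∀ e f g, times e (star (times (times e f) g) f) = times (times e f) g
  SP2 : ∀ e f g, star (times f (star g (star f e))) e = star g (star f e)

/-- The partial order `e ≤_P f ↔ e = f × e` of a projection algebra. -/
def projLE {P : Type u} (times : P → P → P) (e f : P) : Prop := e = times f e

/-- The relation `p 𝓕 q ↔ p = p × q ∧ q = p ⋆ q`. -/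
def friendly {P : Type u} (times star : P → P → P) (p q : P) : Prop :=
  p = times p q ∧ q = star p q

/-- A `P`-path `(p₁, …, pₖ)`, `k ≥ 1`, with `p₁ 𝓕 p₂ 𝓕 ⋯ 𝓕 pₖ`; here `head = p₁` and
`tail = [p₂, …, pₖ]`. -/
@[ext]
structure PPath {P : Type u} (times star : P → P → P) : Type u where
  head : P
  tail : List P
  chain : List.IsChain (friendly times star) (head :: tail)

namespace PPath

variable {P : Type u} {times star : P → P → P}

/-- The last entry `pₖ`. -/
def last (p : PPath times star) : P := (p.head :: p.tail).getLast (List.cons_ne_nil _ _)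

/-- The path `(p)` of length 1. -/
def single (p : P) : PPath times star := ⟨p, [], List.isChain_singleton p⟩

/-- The path `(p, q)` of length 2. -/
def pair (p q : P) (h : friendly times star p q) : PPath times star :=
  ⟨p, [q], List.isChain_pair.2 h⟩

/-- `(p₁, …, pₖ) ∘ (q₁, …, qₗ) = (p₁, …, pₖ = q₁, q₂, …, qₗ)`. -/
def comp (p q : PPath times star) (h : p.last = q.head) : PPath times star where
  head := p.head
  tail := p.tail ++ q.tail
  chain := by
    have hq := q.chain
    rw [← List.cons_append]
    refine List.IsChain.append p.chain hq.tail ?_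
    intro x hx y hy
    rw [List.getLast?_eq_some_getLast (List.cons_ne_nil _ _), Option.mem_some_iff] at hx
    subst hx
    cases hqt : q.tail with
    | nil => rw [hqt] at hy; simp at hy
    | cons z t =>
      rw [hqt] at hy hq
      have hz : z = y := by simpa using hy
      subst hz
      change friendly times star p.last z
      rw [h]
      exact (List.isChain_cons_cons.1 hq).1

/-- From `q` and `[p₂, …, pₖ]`, the list `[q₂, …, qₖ]` with `q₁ = q` and `qᵢ = qᵢ₋₁ ⋆ pᵢ`. -/
def restrictTail (star : P → P → P) : P → List P → List P
  | _, [] => []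
  | q, p :: ps => star q p :: restrictTail star (star q p) ps

/-- The order of the path category: `𝔭 ≤ 𝔮` if `𝔭` is the left restriction of `𝔮` to
some `r ≤_P q₁`. -/
def LE (p q : PPath times star) : Prop :=
  ∃ r, projLE times r q.head ∧ p.head = r ∧ p.tail = restrictTail star r q.tail

/-- The image of a path under a map which preserves `×` and `⋆`. -/
def map {Q : Type v} {times' star' : Q → Q → Q} (g : P → Q)
    (ht : ∀ e f, g (times e f) = times' (g e) (g f))
    (hs : ∀ e f, g (star e f) = star' (g e) (g f)) (p : PPath times star) :
    PPath times' star' where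
  head := g p.head
  tail := p.tail.map g
  chain := by
    rw [← List.map_cons, List.isChain_map]
    refine p.chain.imp ?_
    rintro a b ⟨h1, h2⟩
    exact ⟨(congrArg g h1).trans (ht _ _), (congrArg g h2).trans (hs _ _)⟩

end PPath

namespace IsStrongProjAlg

variable {P : Type u} {times star : P → P → P}

theorem times_le (h : IsStrongProjAlg times star) (e f : P) :
    projLE times (times e f) e := by
  have := h.L4 e e f
  rwa [h.L1] at this

theorem star_le (h : IsStrongProjAlg times star) (e f : P) :
    projLE times (star e f) f := (h.P4_star e f).symm

theorem star_eq_of_le (h : IsStrongProjAlg times star) {e f : P} (hef : projLE times e f) :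
    star e f = e := by
  have := h.P4_times f e
  rwa [← (show e = times f e from hef)] at this

theorem star_eq_of_le' (h : IsStrongProjAlg times star) {e f : P} (hef : projLE times e f) :
    star f e = e := by
  have := h.R2 f e
  rw [h.star_eq_of_le hef] at this
  exact this.symm

theorem times_eq_of_le (h : IsStrongProjAlg times star) {e f : P} (hef : projLE times e f) :
    times e f = e := by
  have := h.L2 f e
  rwa [← (show e = times f e from hef)] at this

theorem times_star_self (h : IsStrongProjAlg times star) (e f : P) :
    times e (star e f) = times e f := by
  have := h.P3_times f f e
  rwa [h.times_eq_of_le (h.star_le e f), h.L1] at this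

theorem star_times_self (h : IsStrongProjAlg times star) (e f : P) :
    star (times e f) f = star e f := by
  have := h.P3_star e e f
  rwa [h.star_eq_of_le' (h.times_le e f), h.R1] at this

/-- `e × f` and `e ⋆ f` form a path. -/
theorem friendly_times_star (h : IsStrongProjAlg times star) (e f : P) :
    friendly times star (times e f) (star e f) := by
  constructor
  · rw [h.L4, h.times_star_self, h.L1]
  · rw [h.R4, h.star_times_self, h.R1]

theorem times_eq_of_times_eq_of_le (h : IsStrongProjAlg times star) {p q r : P}
    (hpq : p = times p q) (hqr : projLE times q r) : p = times p r := by
  calc p = times p (times r q) := by rw [← (show q = times r q from hqr)]; exact hpq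
    _ = times (times p r) q := by rw [h.L3, ← (show q = times r q from hqr)]
    _ = times (times p r) (times p q) := h.L4 _ _ _
    _ = times p r := by rw [← hpq, h.L2]

theorem star_eq_of_star_eq_of_le (h : IsStrongProjAlg times star) {p q r : P}
    (hpq : q = star p q) (hpr : projLE times p r) : q = star r q := by
  have hp : star p r = p := h.star_eq_of_le hpr
  calc q = star (star p r) q := by rw [hp]; exact hpq
    _ = star p (star r q) := by rw [h.R3, hp]
    _ = star (star p q) (star r q) := h.R4 _ _ _
    _ = star r q := by rw [← hpq, ← h.R2]

end IsStrongProjAlg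

/-! ### Ordered categories -/

/-- A small category in single-sorted form: `a ∘ b` is defined precisely when `r(a) = d(b)`. -/
structure SmallCat (C : Type u) : Type u where
  dom : C → C
  cod : C → C
  comp : (a b : C) → cod a = dom b → C
  dom_comp : ∀ a b h, dom (comp a b h) = dom a
  cod_comp : ∀ a b h, cod (comp a b h) = cod b
  assoc : ∀ a b c (h : cod a = dom b) (k : cod b = dom c),
    comp (comp a b h) c ((cod_comp a b h).trans k) =
      comp a (comp b c k) (h.trans (dom_comp b c k).symm)
  cod_dom : ∀ a, cod (dom a) = dom a
  dom_cod : ∀ a, cod a = dom (cod a)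
  id_comp : ∀ a, comp (dom a) a (cod_dom a) = a
  comp_id : ∀ a, comp a (cod a) (dom_cod a) = a

namespace SmallCat

variable {C : Type u} (K : SmallCat C)

/-- The set of objects `P_C = {d(x) | x ∈ C} = {r(x) | x ∈ C}`. -/
def Obj : Type u := {p : C // ∃ x, K.dom x = p}

instance : CoeOut K.Obj C := ⟨Subtype.val⟩

def domObj (a : C) : K.Obj := ⟨K.dom a, a, rfl⟩

def codObj (a : C) : K.Obj := ⟨K.cod a, K.cod a, (K.dom_cod a).symm⟩

end SmallCat

/-- `(C, ∘, d, r, ≤)` is an ordered category. -/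
structure IsOrderedCat {C : Type u} (K : SmallCat C) (le : C → C → Prop) : Prop where
  refl : ∀ a, le a a
  antisymm : ∀ a b, le a b → le b a → a = b
  trans : ∀ a b c, le a b → le b c → le a c
  O1_dom : ∀ a b, le a b → le (K.dom a) (K.dom b)
  O1_cod : ∀ a b, le a b → le (K.cod a) (K.cod b)
  O2 : ∀ a b c d (h : K.cod a = K.dom c) (k : K.cod b = K.dom d),
    le a b → le c d → le (K.comp a c h) (K.comp b d k)
  O3 : ∀ (a : C) (p : K.Obj), le p (K.dom a) → ∃! u, le u a ∧ K.dom u = p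
  O4 : ∀ (a : C) (q : K.Obj), le q (K.cod a) → ∃! v, le v a ∧ K.cod v = q

namespace IsOrderedCat

variable {C : Type u} {K : SmallCat C} {le : C → C → Prop}

/-- The left restriction of `a` to `p ≤ d(a)`. -/
noncomputable def lres (h : IsOrderedCat K le) (p : K.Obj) (a : C) (hp : le p (K.dom a)) : C :=
  (h.O3 a p hp).choose

/-- The right restriction of `a` to `q ≤ r(a)`. -/
noncomputable def rres (h : IsOrderedCat K le) (a : C) (q : K.Obj) (hq : le q (K.cod a)) : C :=
  (h.O4 a q hq).choose

theorem lres_le (h : IsOrderedCat K le) (p : K.Obj) (a : C) (hp : le p (K.dom a)) :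
    le (h.lres p a hp) a := (h.O3 a p hp).choose_spec.1.1

theorem dom_lres (h : IsOrderedCat K le) (p : K.Obj) (a : C) (hp : le p (K.dom a)) :
    K.dom (h.lres p a hp) = p := (h.O3 a p hp).choose_spec.1.2

theorem rres_le (h : IsOrderedCat K le) (a : C) (q : K.Obj) (hq : le q (K.cod a)) :
    le (h.rres a q hq) a := (h.O4 a q hq).choose_spec.1.1

theorem cod_rres (h : IsOrderedCat K le) (a : C) (q : K.Obj) (hq : le q (K.cod a)) :
    K.cod (h.rres a q hq) = q := (h.O4 a q hq).choose_spec.1.2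

end IsOrderedCat

/-! ### Chain projection ordered categories -/

/-- The data `(∘, d, r, ≤, ×, ⋆, ε)` on `C`: a small category with a relation `≤`, two binary
operations on its set of objects, and a map from the paths of objects to `C`. -/
structure CPOData (C : Type u) extends SmallCat C where
  le : C → C → Prop
  times : toSmallCat.Obj → toSmallCat.Obj → toSmallCat.Obj
  star : toSmallCat.Obj → toSmallCat.Obj → toSmallCat.Obj
  eval : PPath times star → C

/-- A weak projection ordered category. -/
structure IsWeakPOC {C : Type u} (D : CPOData C) : Prop where
  ordered : IsOrderedCat D.toSmallCat D.le
  strong : IsStrongProjAlg D.times D.star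
  le_iff : ∀ p q : D.Obj, D.le p q ↔ projLE D.times p q

namespace IsWeakPOC

variable {C : Type u} {D : CPOData C}

theorem star_dom_le (h : IsWeakPOC D) (x : D.Obj) (a : C) :
    D.le (D.star x (D.domObj a) : D.Obj) (D.dom a) :=
  (h.le_iff _ (D.domObj a)).2 (h.strong.star_le _ _)

theorem cod_times_le (h : IsWeakPOC D) (a : C) (y : D.Obj) :
    D.le (D.times (D.codObj a) y : D.Obj) (D.cod a) :=
  (h.le_iff _ (D.codObj a)).2 (h.strong.times_le _ _)

/-- `x Θ_a = r(u)`, where `u` is the left restriction of `a` to `x ⋆ d(a)`. -/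
noncomputable def Theta (h : IsWeakPOC D) (a : C) (x : D.Obj) : D.Obj :=
  D.codObj (h.ordered.lres (D.star x (D.domObj a)) a (h.star_dom_le x a))

/-- `y Δ_a = d(v)`, where `v` is the right restriction of `a` to `r(a) × y`. -/
noncomputable def Delta (h : IsWeakPOC D) (a : C) (y : D.Obj) : D.Obj :=
  D.domObj (h.ordered.rres a (D.times (D.codObj a) y) (h.cod_times_le a y))

theorem Theta_le (h : IsWeakPOC D) (a : C) (x : D.Obj) :
    projLE D.times (h.Theta a x) (D.codObj a) :=
  (h.le_iff _ _).1 (h.ordered.O1_cod _ _ (h.ordered.lres_le _ _ _))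

theorem Delta_le (h : IsWeakPOC D) (a : C) (y : D.Obj) :
    projLE D.times (h.Delta a y) (D.domObj a) :=
  (h.le_iff _ _).1 (h.ordered.O1_dom _ _ (h.ordered.rres_le _ _ _))

end IsWeakPOC

/-- A projection ordered category. With maps written on the right, `q θ_p = q ⋆ p` and
`q δ_p = p × q`, the last two conditions read `δ_{pΘ_a} = Δ_a δ_p Θ_a` and
`θ_{pΔ_a} = Θ_a θ_p Δ_a`. -/
structure IsPOC {C : Type u} (D : CPOData C) : Prop extends IsWeakPOC D where
  times_Theta : ∀ (a : C) (p x : D.Obj),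
    D.times (toIsWeakPOC.Theta a p) x =
      toIsWeakPOC.Theta a (D.times p (toIsWeakPOC.Delta a x))
  star_Delta : ∀ (a : C) (p x : D.Obj),
    D.star x (toIsWeakPOC.Delta a p) =
      toIsWeakPOC.Delta a (D.star (toIsWeakPOC.Theta a x) p)

/-- `ε` is an evaluation map. -/
structure IsEvaluation {C : Type u} (D : CPOData C) : Prop where
  E1_single : ∀ p : D.Obj, D.eval (PPath.single p) = p
  E1_pair : ∀ (p : D.Obj) (h : friendly D.times D.star p p), D.eval (PPath.pair p p h) = p
  E2_dom : ∀ p : PPath D.times D.star, D.dom (D.eval p) = p.head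
  E2_cod : ∀ p : PPath D.times D.star, D.cod (D.eval p) = p.last
  E3 : ∀ (p q : PPath D.times D.star) (h : p.last = q.head),
    D.eval (p.comp q h) = D.comp (D.eval p) (D.eval q)
      ((E2_cod p).trans ((congrArg Subtype.val h).trans (E2_dom q).symm))
  E4 : ∀ p q : PPath D.times D.star, p.LE q → D.le (D.eval p) (D.eval q)

namespace IsEvaluation

variable {C : Type u} {D : CPOData C}

theorem dom_pair (hε : IsEvaluation D) {p q : D.Obj} (h : friendly D.times D.star p q) :
    D.dom (D.eval (PPath.pair p q h)) = p := hε.E2_dom _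

theorem cod_pair (hε : IsEvaluation D) {p q : D.Obj} (h : friendly D.times D.star p q) :
    D.cod (D.eval (PPath.pair p q h)) = q := hε.E2_cod _

end IsEvaluation

namespace IsPOC

variable {C : Type u} {D : CPOData C}

/-- `(e, f)` is a `b`-linked pair: `f = e Θ_b θ_f` and `e = f Δ_b δ_e`. -/
def Linked (h : IsPOC D) (b : C) (e f : D.Obj) : Prop :=
  f = D.star (h.Theta b e) f ∧ e = D.times e (h.Delta b f)

theorem Linked.friendly_e₁ {h : IsPOC D} {b : C} {e f : D.Obj} (l : h.Linked b e f) :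
    friendly D.times D.star e (D.star e (D.domObj b)) := by
  have he : e = D.times e (D.domObj b) :=
    h.strong.times_eq_of_times_eq_of_le l.2 (h.Delta_le b f)
  have := h.strong.friendly_times_star e (D.domObj b)
  rwa [← he] at this

theorem Linked.friendly_f₁ {h : IsPOC D} {b : C} {e f : D.Obj} (l : h.Linked b e f) :
    friendly D.times D.star (h.Theta b e) f := by
  refine ⟨?_, l.1⟩
  rw [h.times_Theta, ← l.2]

theorem Linked.friendly_e₂ {h : IsPOC D} {b : C} {e f : D.Obj} (l : h.Linked b e f) :
    friendly D.times D.star e (h.Delta b f) := by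
  refine ⟨l.2, ?_⟩
  rw [h.star_Delta, ← l.1]

theorem Linked.friendly_f₂ {h : IsPOC D} {b : C} {e f : D.Obj} (l : h.Linked b e f) :
    friendly D.times D.star (D.times (D.codObj b) f) f := by
  have hf : f = D.star (D.codObj b) f :=
    h.strong.star_eq_of_star_eq_of_le l.1 (h.Theta_le b e)
  have := h.strong.friendly_times_star (D.codObj b) f
  rwa [← hf] at this

/-- `λ(e,b,f) = ε(e,e₁) ∘ b' ∘ ε(f₁,f)`, where `e₁ = e ⋆ d(b)`, `f₁ = e Θ_b` and `b'` is the left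
restriction of `b` to `e₁`. -/
noncomputable def lam (h : IsPOC D) (hε : IsEvaluation D) {b : C} {e f : D.Obj}
    (l : h.Linked b e f) : C :=
  D.comp
    (D.comp (D.eval (PPath.pair e (D.star e (D.domObj b)) l.friendly_e₁))
      (h.ordered.lres (D.star e (D.domObj b)) b (h.star_dom_le e b))
      ((hε.cod_pair _).trans (h.ordered.dom_lres _ _ _).symm))
    (D.eval (PPath.pair (h.Theta b e) f l.friendly_f₁))
    ((D.cod_comp _ _ _).trans (hε.dom_pair l.friendly_f₁).symm)

/-- `ρ(e,b,f) = ε(e,e₂) ∘ b' ∘ ε(f₂,f)`, where `e₂ = f Δ_b`, `f₂ = r(b) × f` and `b'` is the right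
restriction of `b` to `f₂`. -/
noncomputable def rho (h : IsPOC D) (hε : IsEvaluation D) {b : C} {e f : D.Obj}
    (l : h.Linked b e f) : C :=
  D.comp
    (D.comp (D.eval (PPath.pair e (h.Delta b f) l.friendly_e₂))
      (h.ordered.rres b (D.times (D.codObj b) f) (h.cod_times_le b f))
      (hε.cod_pair l.friendly_e₂))
    (D.eval (PPath.pair (D.times (D.codObj b) f) f l.friendly_f₂))
    ((D.cod_comp _ _ _).trans ((h.ordered.cod_rres _ _ _).trans (hε.dom_pair _).symm))

end IsPOC

/-- A chain projection ordered category. -/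
structure IsCPOC {C : Type u} (D : CPOData C) : Prop extends IsPOC D where
  evaluation : IsEvaluation D
  G2 : ∀ (b : C) (e f : D.Obj) (l : toIsPOC.Linked b e f),
    toIsPOC.lam evaluation l = toIsPOC.rho evaluation l

/-- The map on objects induced by a map that commutes with `d`. -/
def mapObj {C₁ : Type u} {C₂ : Type v} {K₁ : SmallCat C₁} {K₂ : SmallCat C₂} (φ : C₁ → C₂)
    (h : ∀ a, K₂.dom (φ a) = φ (K₁.dom a)) (p : K₁.Obj) : K₂.Obj :=
  ⟨φ p, φ p, (h p).trans (congrArg φ (by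
    obtain ⟨_, x, rfl⟩ := p
    exact (congrArg K₁.dom (K₁.cod_dom x).symm).trans ((K₁.dom_cod _).symm.trans (K₁.cod_dom x))))⟩

/-- A chain projection ordered functor. -/
structure IsCPOFunctor {C₁ : Type u} {C₂ : Type v} (D₁ : CPOData C₁) (D₂ : CPOData C₂)
    (φ : C₁ → C₂) : Prop where
  F1_dom : ∀ a, D₂.dom (φ a) = φ (D₁.dom a)
  F1_cod : ∀ a, D₂.cod (φ a) = φ (D₁.cod a)
  F2 : ∀ a b (h : D₁.cod a = D₁.dom b), φ (D₁.comp a b h) =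
    D₂.comp (φ a) (φ b) ((F1_cod a).trans ((congrArg φ h).trans (F1_dom b).symm))
  F3 : ∀ a b, D₁.le a b → D₂.le (φ a) (φ b)
  F4_times : ∀ e f : D₁.Obj,
    mapObj φ F1_dom (D₁.times e f) = D₂.times (mapObj φ F1_dom e) (mapObj φ F1_dom f)
  F4_star : ∀ e f : D₁.Obj,
    mapObj φ F1_dom (D₁.star e f) = D₂.star (mapObj φ F1_dom e) (mapObj φ F1_dom f)
  F5 : ∀ p : PPath D₁.times D₁.star,
    φ (D₁.eval p) = D₂.eval (p.map (mapObj φ F1_dom) F4_times F4_star)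

/-- The objects of the category of (non-empty) chain projection ordered categories. -/
structure CPOC : Type (u + 1) where
  carrier : Type u
  nonempty : Nonempty carrier
  data : CPOData carrier
  isCPOC : IsCPOC data

namespace CPOC

@[ext]
structure Hom (C₁ C₂ : CPOC.{u}) : Type u where
  toFun : C₁.carrier → C₂.carrier
  isFunctor : IsCPOFunctor C₁.data C₂.data toFun

theorem isCPOFunctor_id {C : Type u} (D : CPOData C) : IsCPOFunctor D D (fun x => x) where
  F1_dom _ := rfl
  F1_cod _ := rfl
  F2 _ _ _ := rfl
  F3 _ _ h := h
  F4_times _ _ := rfl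
  F4_star _ _ := rfl
  F5 _ := congrArg D.eval (PPath.ext rfl (List.map_id _).symm)

theorem isCPOFunctor_comp {C₁ C₂ C₃ : Type u} {D₁ : CPOData C₁} {D₂ : CPOData C₂}
    {D₃ : CPOData C₃} {φ : C₁ → C₂} {ψ : C₂ → C₃} (f : IsCPOFunctor D₁ D₂ φ)
    (g : IsCPOFunctor D₂ D₃ ψ) : IsCPOFunctor D₁ D₃ (fun x => ψ (φ x)) where
  F1_dom a := (g.F1_dom _).trans (congrArg ψ (f.F1_dom a))
  F1_cod a := (g.F1_cod _).trans (congrArg ψ (f.F1_cod a))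
  F2 a b h := (congrArg ψ (f.F2 a b h)).trans (g.F2 _ _ _)
  F3 _ _ h := g.F3 _ _ (f.F3 _ _ h)
  F4_times e e' := (congrArg (mapObj ψ g.F1_dom) (f.F4_times e e')).trans (g.F4_times _ _)
  F4_star e e' := (congrArg (mapObj ψ g.F1_dom) (f.F4_star e e')).trans (g.F4_star _ _)
  F5 p := (congrArg ψ (f.F5 p)).trans ((g.F5 _).trans
    (congrArg D₃.eval (PPath.ext rfl List.map_map)))

instance : Category CPOC.{u} where
  Hom C₁ C₂ := Hom C₁ C₂
  id C := ⟨fun x => x, isCPOFunctor_id C.data⟩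
  comp f g := ⟨fun x => g.toFun (f.toFun x), isCPOFunctor_comp f.isFunctor g.isFunctor⟩

end CPOC

/-! ### The construction `C` -/

/-- The category of a DRC-restriction semigroup `S` under the restricted product:
`a ∘ b = ab`, defined when `a* = b⁺`, with `d(a) = a⁺` and `r(a) = a*`. -/
def restrictedCat {S : Type u} [BiUnary S] (hS : IsDRCRestriction S) : SmallCat S where
  dom := plus
  cod := ast
  comp a b _ := a * b
  dom_comp a b h := by
    rw [hS.plus_congr, ← h, hS.mul_ast]
  cod_comp a b h := by
    rw [hS.ast_congr, h, hS.plus_mul]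
  assoc a b c _ _ := hS.mul_assoc a b c
  cod_dom := hS.ast_plus
  dom_cod a := (hS.plus_ast a).symm
  id_comp := hS.plus_mul
  comp_id := hS.mul_ast

/-- The natural order `a ≤ b ↔ a = a⁺ b ∧ b⁺ a⁺ b⁺ = a⁺` of a DRC-restriction semigroup. -/
def naturalLE {S : Type u} [BiUnary S] (a b : S) : Prop :=
  a = plus a * b ∧ plus b * plus a * plus b = plus a

/-- The data of `C(S)`: the restricted product, `d(a) = a⁺`, `r(a) = a*`, the natural order,
`e × f = (ef)⁺`, `e ⋆ f = (ef)*` and `ε(p₁, …, pₖ) = p₁ ⋯ pₖ`. -/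
def cData {S : Type u} [BiUnary S] (hS : IsDRCRestriction S) : CPOData S where
  toSmallCat := restrictedCat hS
  le := naturalLE
  times e f := ⟨plus (e.1 * f.1), e.1 * f.1, rfl⟩
  star e f := ⟨ast (e.1 * f.1), ast (e.1 * f.1), hS.plus_ast _⟩
  eval p := p.tail.foldl (fun x q => x * q.1) p.head.1

/-! ### The construction `S` -/

/-- The pseudo-product `a • b = a' ∘ ε(r(a) × d(b), r(a) ⋆ d(b)) ∘ b'`, where `a'` is the right
restriction of `a` to `r(a) × d(b)` and `b'` the left restriction of `b` to `r(a) ⋆ d(b)`. -/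
noncomputable def pseudoProduct {C : Type u} {D : CPOData C} (h : IsCPOC D) (a b : C) : C :=
  D.comp
    (D.comp
      (h.ordered.rres a (D.times (D.codObj a) (D.domObj b)) (h.cod_times_le a (D.domObj b)))
      (D.eval (PPath.pair _ _ (h.strong.friendly_times_star (D.codObj a) (D.domObj b))))
      ((h.ordered.cod_rres _ _ _).trans (h.evaluation.dom_pair _).symm))
    (h.ordered.lres (D.star (D.codObj a) (D.domObj b)) b (h.star_dom_le (D.codObj a) b))
    ((D.cod_comp _ _ _).trans
      ((h.evaluation.cod_pair _).trans (h.ordered.dom_lres _ _ _).symm))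

/-- The operations of `S(C)`: the pseudo-product, `a⁺ = d(a)` and `a* = r(a)`. -/
noncomputable abbrev sData {C : Type u} {D : CPOData C} (h : IsCPOC D) : BiUnary C where
  mul := pseudoProduct h
  plus := D.dom
  ast := D.cod

/-! ### The two functors -/

/-- `C` as a functor, identical on underlying sets and maps; the hypotheses say that `C` sends
objects to objects and morphisms to morphisms. -/
def functorC
    (hobj : ∀ S : DRS.{u}, IsCPOC (cData S.isDRCRestriction))
    (hmap : ∀ (S T : DRS.{u}) (f : S ⟶ T),
      IsCPOFunctor (cData S.isDRCRestriction) (cData T.isDRCRestriction) f.toFun) :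
    DRS.{u} ⥤ CPOC.{u} where
  obj S := ⟨S.carrier, S.nonempty, cData S.isDRCRestriction, hobj S⟩
  map f := ⟨f.toFun, hmap _ _ f⟩
  map_id _ := rfl
  map_comp _ _ := rfl

/-- `S` as a functor, identical on underlying sets and maps; the hypotheses say that `S` sends
objects to objects and morphisms to morphisms. -/
noncomputable def functorS
    (hobj : ∀ C : CPOC.{u}, @IsDRCRestriction C.carrier (sData C.isCPOC))
    (hmap : ∀ (C₁ C₂ : CPOC.{u}) (f : C₁ ⟶ C₂),
      @IsBiUnaryHom C₁.carrier C₂.carrier (sData C₁.isCPOC) (sData C₂.isCPOC) f.toFun) :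
    CPOC.{u} ⥤ DRS.{u} where
  obj C := ⟨C.carrier, C.nonempty, sData C.isCPOC, hobj C⟩
  map f := ⟨f.toFun, hmap _ _ f⟩
  map_id _ := rfl
  map_comp _ _ := rfl

end DRC


/-! A projection `p` acts on an element `a` by multiplication and on an arrow `a` by restriction;
in both pictures the result is the unique element below `a` whose domain (codomain) is the given
projection. In the semigroup, the ample identities make the natural order left-right symmetric, so
that restriction is available on both sides. In the category, the pseudo-product bridges arrows
`u ≤ a` and `v ≤ b` with `r(u) 𝓕 d(v)` by `ε(r(u), d(v))`. Restricting `a` and `c` far enough turns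
`(a • b) • c` into `u ∘ λ(e, b, f) ∘ v` and `a • (b • c)` into `u ∘ ρ(e, b, f) ∘ v` for one
`b`-linked pair `(e, f)`, and linked pairs are exactly those for which `λ = ρ`. -/

namespace DRC

open BiUnary MulOpposite

/-! ### DRC-restriction semigroups -/

/-- The dual of a bi-unary algebra: the product is reversed, and `⁺` and `*` are exchanged. -/
instance {S : Type u} [BiUnary S] : BiUnary Sᵐᵒᵖ where
  plus x := op (ast x.unop)
  ast x := op (plus x.unop)

namespace IsDRCSemigroup

variable {S : Type u} [BiUnary S]

theorem dual (hS : IsDRCSemigroup S) : IsDRCSemigroup Sᵐᵒᵖ where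
  mul_assoc _ _ _ := congrArg op (hS.mul_assoc _ _ _).symm
  plus_mul _ := congrArg op (hS.mul_ast _)
  mul_ast _ := congrArg op (hS.plus_mul _)
  plus_congr _ _ := congrArg op (hS.ast_congr _ _)
  ast_congr _ _ := congrArg op (hS.plus_congr _ _)
  plus_reduced _ _ := congrArg op ((hS.ast_reduced _ _).trans (hS.mul_assoc _ _ _))
  ast_reduced _ _ := congrArg op ((hS.plus_reduced _ _).trans (hS.mul_assoc _ _ _))
  plus_plus _ := congrArg op (hS.ast_ast _)
  ast_ast _ := congrArg op (hS.plus_plus _)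
  ast_plus _ := congrArg op (hS.plus_ast _)
  plus_ast _ := congrArg op (hS.ast_plus _)

theorem ast_eq_of_plus_eq (hS : IsDRCSemigroup S) {e : S} (he : plus e = e) : ast e = e := by
  rw [← he, hS.ast_plus]

theorem mul_self_of_plus_eq (hS : IsDRCSemigroup S) {e : S} (he : plus e = e) : e * e = e := by
  simpa only [he] using hS.plus_mul e

theorem plus_mul_plus_mul (hS : IsDRCSemigroup S) (x y : S) :
    plus x * plus (x * y) = plus (x * y) := by
  rw [hS.plus_reduced x y, ← hS.mul_assoc, ← hS.mul_assoc,
    hS.mul_self_of_plus_eq (hS.plus_plus x)]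

theorem plus_mul_mul_plus (hS : IsDRCSemigroup S) (x y : S) :
    plus (x * y) * plus x = plus (x * y) := by
  rw [hS.plus_reduced x y, hS.mul_assoc, hS.mul_self_of_plus_eq (hS.plus_plus x)]

theorem ast_mul_mul_ast (hS : IsDRCSemigroup S) (x y : S) :
    ast (x * y) * ast y = ast (x * y) :=
  congrArg unop (hS.dual.plus_mul_plus_mul (op y) (op x))

theorem ast_mul_ast_mul (hS : IsDRCSemigroup S) (x y : S) :
    ast y * ast (x * y) = ast (x * y) :=
  congrArg unop (hS.dual.plus_mul_mul_plus (op y) (op x))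

theorem plus_proj_mul_mul_proj (hS : IsDRCSemigroup S) {e : S} (he : plus e = e) (y : S) :
    plus (e * y) * e = plus (e * y) := by
  simpa only [he] using hS.plus_mul_mul_plus e y

theorem proj_mul_ast_mul_proj (hS : IsDRCSemigroup S) {f : S} (hf : plus f = f) (x : S) :
    f * ast (x * f) = ast (x * f) := by
  simpa only [hS.ast_eq_of_plus_eq hf] using hS.ast_mul_ast_mul x f

theorem plus_proj_mul_mul (hS : IsDRCSemigroup S) {e : S} (he : plus e = e) (y : S) :
    plus (e * y) * y = e * y :=
  calc plus (e * y) * y = plus (e * y) * (e * y) := by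
        rw [← hS.mul_assoc, hS.plus_proj_mul_mul_proj he]
    _ = e * y := hS.plus_mul _

theorem mul_ast_mul_proj (hS : IsDRCSemigroup S) {f : S} (hf : plus f = f) (x : S) :
    x * ast (x * f) = x * f :=
  congrArg unop (hS.dual.plus_proj_mul_mul (congrArg op (hS.ast_eq_of_plus_eq hf)) (op x))

theorem plus_proj_mul_ast_proj (hS : IsDRCSemigroup S) {e f : S} (he : plus e = e)
    (hf : plus f = f) : plus (e * f) * ast (e * f) = e * f := by
  rw [← hS.proj_mul_ast_mul_proj hf, ← hS.mul_assoc, hS.plus_proj_mul_mul he, hS.mul_ast]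

theorem times_times (hS : IsDRCSemigroup S) {e : S} (he : plus e = e) (f g : S) :
    plus (e * plus (f * g)) = plus (plus (e * f) * plus (f * g)) := by
  rw [← hS.plus_congr, ← hS.plus_congr, ← hS.mul_assoc, ← hS.mul_assoc,
    hS.plus_proj_mul_mul he]

theorem times_times_left (hS : IsDRCSemigroup S) {e : S} (he : plus e = e) (f g : S) :
    plus (plus (e * f) * g) = plus (plus (e * f) * plus (e * g)) := by
  rw [← hS.plus_congr, ← hS.mul_assoc, hS.plus_proj_mul_mul_proj he]

theorem star_times_star (hS : IsDRCSemigroup S) {f : S} (hf : plus f = f) (e g : S) :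
    ast (ast (e * plus (f * g)) * g) = ast (ast (e * f) * g) := by
  rw [← hS.ast_congr, ← hS.ast_congr, hS.mul_assoc, hS.plus_proj_mul_mul hf, ← hS.mul_assoc]

theorem naturalLE_iff (hS : IsDRCSemigroup S) (a b : S) :
    naturalLE a b ↔ a = plus a * b ∧ plus b * plus a = plus a ∧ plus a * plus b = plus a := by
  refine and_congr_right fun _ => ⟨fun h => ⟨?_, ?_⟩, fun h => by rw [h.1, h.2]⟩
  · rw [← h, ← hS.mul_assoc, ← hS.mul_assoc, hS.mul_self_of_plus_eq (hS.plus_plus b)]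
  · rw [← h, hS.mul_assoc, hS.mul_self_of_plus_eq (hS.plus_plus b)]

theorem naturalLE_iff_projLE (hS : IsDRCSemigroup S) {p q : S} (hp : plus p = p)
    (hq : plus q = q) : naturalLE p q ↔ p = plus (q * p) := by
  rw [hS.naturalLE_iff, hp, hq]
  constructor
  · rintro ⟨-, h, -⟩
    rw [h, hp]
  · intro h
    have hqp := hS.plus_mul_plus_mul q p
    have hpq := hS.plus_mul_mul_plus q p
    rw [← h, hq] at hqp hpq
    exact ⟨hpq.symm, hqp, hpq⟩

theorem naturalLE_refl (hS : IsDRCSemigroup S) (a : S) : naturalLE a a :=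
  have idem := hS.mul_self_of_plus_eq (hS.plus_plus a)
  (hS.naturalLE_iff a a).2 ⟨(hS.plus_mul a).symm, idem, idem⟩

theorem naturalLE_antisymm (hS : IsDRCSemigroup S) {a b : S} (hab : naturalLE a b)
    (hba : naturalLE b a) : a = b := by
  obtain ⟨ha, hplus, -⟩ := (hS.naturalLE_iff a b).1 hab
  obtain ⟨-, -, hplus'⟩ := (hS.naturalLE_iff b a).1 hba
  rw [ha, ← hplus, hplus', hS.plus_mul]

theorem naturalLE_trans (hS : IsDRCSemigroup S) {a b c : S} (hab : naturalLE a b)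
    (hbc : naturalLE b c) : naturalLE a c := by
  obtain ⟨ha, hba, hab⟩ := (hS.naturalLE_iff a b).1 hab
  obtain ⟨hb, hcb, hbc⟩ := (hS.naturalLE_iff b c).1 hbc
  refine (hS.naturalLE_iff a c).2 ⟨?_, ?_, ?_⟩
  · rw [← hab, hS.mul_assoc, ← hb, ← ha]
  · rw [← hba, ← hS.mul_assoc, hcb]
  · rw [← hab, hS.mul_assoc, hbc]

theorem plus_naturalLE_plus (hS : IsDRCSemigroup S) {a b : S} (h : naturalLE a b) :
    naturalLE (plus a) (plus b) := by
  obtain ⟨-, hba, hab⟩ := (hS.naturalLE_iff a b).1 h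
  rw [hS.naturalLE_iff, hS.plus_plus, hS.plus_plus]
  exact ⟨hab.symm, hba, hab⟩

theorem plus_mul_of_ast_eq_plus (hS : IsDRCSemigroup S) {a b : S} (h : ast a = plus b) :
    plus (a * b) = plus a := by
  rw [hS.plus_congr, ← h, hS.mul_ast]

theorem mul_naturalLE_mul (hS : IsDRCSemigroup S) {a b c d : S} (hac : ast a = plus c)
    (hbd : ast b = plus d) (hab : naturalLE a b) (hcd : naturalLE c d) :
    naturalLE (a * c) (b * d) := by
  obtain ⟨ha, hplus⟩ := hab
  refine ⟨?_, by rwa [hS.plus_mul_of_ast_eq_plus hac, hS.plus_mul_of_ast_eq_plus hbd]⟩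
  calc a * c = a * (ast a * d) := by rw [hac, ← hcd.1]
    _ = a * d := by rw [← hS.mul_assoc, hS.mul_ast]
    _ = plus (a * c) * (b * d) := by
      rw [hS.plus_mul_of_ast_eq_plus hac, ← hS.mul_assoc, ← ha]

theorem existsUnique_naturalLE_plus_eq (hS : IsDRCSemigroup S) (a : S) {p : S} (hp : plus p = p)
    (h : naturalLE p (plus a)) : ∃! u, naturalLE u a ∧ plus u = p := by
  obtain ⟨-, hap, hpa⟩ := (hS.naturalLE_iff _ _).1 h
  rw [hp, hS.plus_plus] at hap hpa
  have hplus : plus (p * a) = p := by rw [hS.plus_congr, hpa, hp]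
  refine ⟨p * a, ⟨(hS.naturalLE_iff _ _).2 ?_, hplus⟩, ?_⟩
  · rw [hplus]
    exact ⟨rfl, hap, hpa⟩
  · rintro u ⟨hu, rfl⟩
    exact hu.1

end IsDRCSemigroup

namespace IsDRCRestriction

variable {S : Type u} [BiUnary S]

theorem dual (hS : IsDRCRestriction S) : IsDRCRestriction Sᵐᵒᵖ where
  toIsDRCSemigroup := hS.toIsDRCSemigroup.dual
  ample_left _ _ := congrArg op (hS.ample_right _ _)
  ample_right _ _ := congrArg op (hS.ample_left _ _)

theorem times_star_times (hS : IsDRCRestriction S) {e f : S} (he : plus e = e) (hf : plus f = f)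
    (g : S) : plus (e * ast (plus (plus (e * f) * g) * f)) = plus (plus (e * f) * g) := by
  have hk : plus (plus (plus (e * f) * g)) = plus (plus (e * f) * g) := hS.plus_plus _
  have hkef := hS.plus_proj_mul_mul_proj (hS.plus_plus (e * f)) g
  generalize plus (plus (e * f) * g) = k at hk hkef
  have hke : k * e = k := by rw [← hkef, hS.mul_assoc, hS.plus_proj_mul_mul_proj he]
  have hample : e * f * ast (k * f) = k * f := by
    have := hS.ample_left (e * f) k
    rwa [hkef, hS.ast_eq_of_plus_eq hk, ← hS.mul_assoc, hke] at this
  calc plus (e * ast (k * f)) = plus (e * f * ast (k * f)) := by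
        rw [hS.mul_assoc, hS.proj_mul_ast_mul_proj hf]
    _ = plus (k * f) := by rw [hample]
    _ = plus (k * (e * f)) := by rw [← hS.mul_assoc, hke]
    _ = k := by rw [hS.plus_congr, hkef, hk]

/-- With `pΘ_a = (pa)*` and `xΔ_a = (ax)⁺`, this is `(pΘ_a) × x = (p × (xΔ_a))Θ_a`. -/
theorem plus_ast_mul_mul (hS : IsDRCRestriction S) {p : S} (hp : plus p = p) (a x : S) :
    plus (ast (p * a) * x) = ast (plus (p * plus (a * x)) * a) := by
  have hample : plus (p * (a * x)) * a = p * a * plus (ast (p * a) * x) := by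
    have := hS.ample_right (p * a) x
    rwa [hS.mul_assoc p a x, ← hS.mul_assoc _ p a, hS.plus_proj_mul_mul_proj hp] at this
  have habs : ast (p * a) * plus (ast (p * a) * x) = plus (ast (p * a) * x) := by
    simpa only [hS.plus_ast] using hS.plus_mul_plus_mul (ast (p * a)) x
  rw [← hS.plus_congr, hample, hS.ast_congr (p * a), habs, hS.ast_plus]

theorem ast_mul_plus_mul (hS : IsDRCRestriction S) {p : S} (hp : plus p = p) (a x : S) :
    ast (x * plus (a * p)) = plus (a * ast (ast (x * a) * p)) :=
  congrArg unop
    (hS.dual.plus_ast_mul_mul (congrArg op (hS.ast_eq_of_plus_eq hp)) (op a) (op x))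

theorem naturalLE_op (hS : IsDRCRestriction S) {a b : S} (h : naturalLE a b) :
    naturalLE (op a) (op b) := by
  obtain ⟨ha, -, hplus⟩ := (hS.naturalLE_iff a b).1 h
  have hample := hS.ample_left b (plus a)
  rw [hplus, hS.ast_plus, ← ha] at hample
  refine ⟨congrArg op hample.symm, congrArg op ?_⟩
  change ast b * (ast a * ast b) = ast a
  rw [ha, hS.ast_mul_mul_ast, hS.ast_mul_ast_mul]

theorem naturalLE_op_iff (hS : IsDRCRestriction S) {a b : S} :
    naturalLE (op a) (op b) ↔ naturalLE a b := by
  refine ⟨fun h => ?_, hS.naturalLE_op⟩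
  obtain ⟨ha, hplus⟩ := hS.dual.naturalLE_op h
  exact ⟨congrArg (unop ∘ unop) ha, congrArg (unop ∘ unop) hplus⟩

theorem ast_naturalLE_ast (hS : IsDRCRestriction S) {a b : S} (h : naturalLE a b) :
    naturalLE (ast a) (ast b) :=
  hS.naturalLE_op_iff.1 (hS.dual.plus_naturalLE_plus (hS.naturalLE_op h))

theorem existsUnique_naturalLE_ast_eq (hS : IsDRCRestriction S) (a : S) {q : S}
    (hq : plus q = q) (h : naturalLE q (ast a)) : ∃! v, naturalLE v a ∧ ast v = q := by
  obtain ⟨v, ⟨hva, hvq⟩, huniq⟩ := hS.dual.existsUnique_naturalLE_plus_eq (op a)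
    (congrArg op (hS.ast_eq_of_plus_eq hq)) (hS.naturalLE_op h)
  exact ⟨v.unop, ⟨hS.naturalLE_op_iff.1 hva, congrArg unop hvq⟩, fun w hw =>
    congrArg unop (huniq (op w) ⟨hS.naturalLE_op hw.1, congrArg op hw.2⟩)⟩

theorem plus_obj (hS : IsDRCRestriction S) (e : (cData hS).Obj) : plus e.1 = e.1 := by
  obtain ⟨_, x, rfl⟩ := e
  exact hS.plus_plus x

theorem ast_obj (hS : IsDRCRestriction S) (e : (cData hS).Obj) : ast e.1 = e.1 :=
  hS.ast_eq_of_plus_eq (hS.plus_obj e)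

theorem isOrderedCat (hS : IsDRCRestriction S) : IsOrderedCat (restrictedCat hS) naturalLE where
  refl := hS.naturalLE_refl
  antisymm _ _ := hS.naturalLE_antisymm
  trans _ _ _ := hS.naturalLE_trans
  O1_dom _ _ := hS.plus_naturalLE_plus
  O1_cod _ _ := hS.ast_naturalLE_ast
  O2 _ _ _ _ := hS.mul_naturalLE_mul
  O3 a p := hS.existsUnique_naturalLE_plus_eq a (hS.plus_obj p)
  O4 a q := hS.existsUnique_naturalLE_ast_eq a (hS.plus_obj q)

theorem isStrongProjAlg (hS : IsDRCRestriction S) :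
    IsStrongProjAlg (cData hS).times (cData hS).star where
  L1 e := Subtype.ext <|
    (congrArg plus (hS.mul_self_of_plus_eq (hS.plus_obj e))).trans (hS.plus_obj e)
  L2 e f := Subtype.ext <|
    (congrArg plus (hS.plus_proj_mul_mul_proj (hS.plus_obj e) f.1)).trans (hS.plus_plus _)
  L3 e f g := Subtype.ext (hS.times_times (hS.plus_obj e) f.1 g.1)
  L4 e f g := Subtype.ext (hS.times_times_left (hS.plus_obj e) f.1 g.1)
  R1 e := Subtype.ext <|
    (congrArg ast (hS.mul_self_of_plus_eq (hS.plus_obj e))).trans (hS.ast_obj e)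
  R2 e f := Subtype.ext <| Eq.symm <|
    (congrArg ast (hS.proj_mul_ast_mul_proj (hS.plus_obj e) f.1)).trans (hS.ast_ast _)
  R3 e f g := Subtype.ext <| congrArg unop <|
    hS.dual.times_times (congrArg op (hS.ast_obj e)) (op f.1) (op g.1)
  R4 e f g := Subtype.ext <| congrArg unop <|
    hS.dual.times_times_left (congrArg op (hS.ast_obj e)) (op f.1) (op g.1)
  P3_star e f g := Subtype.ext (hS.star_times_star (hS.plus_obj f) e.1 g.1)
  P3_times e f g := Subtype.ext <| congrArg unop <|
    hS.dual.star_times_star (congrArg op (hS.ast_obj f)) (op e.1) (op g.1)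
  P4_times e f := Subtype.ext <|
    (congrArg ast (hS.plus_proj_mul_mul_proj (hS.plus_obj e) f.1)).trans (hS.ast_plus _)
  P4_star e f := Subtype.ext <|
    (congrArg plus (hS.proj_mul_ast_mul_proj (hS.plus_obj f) e.1)).trans (hS.plus_ast _)
  SP1 e f g := Subtype.ext (hS.times_star_times (hS.plus_obj e) (hS.plus_obj f) g.1)
  SP2 e f g := Subtype.ext <| congrArg unop <| hS.dual.times_star_times
    (congrArg op (hS.ast_obj e)) (congrArg op (hS.ast_obj f)) (op g.1)

theorem isWeakPOC (hS : IsDRCRestriction S) : IsWeakPOC (cData hS) where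
  ordered := hS.isOrderedCat
  strong := hS.isStrongProjAlg
  le_iff p q := (hS.naturalLE_iff_projLE (hS.plus_obj p) (hS.plus_obj q)).trans
    ⟨fun h => Subtype.ext h, fun h => congrArg Subtype.val h⟩

theorem lres_eq_mul (hS : IsDRCRestriction S)
    (h : IsOrderedCat (cData hS).toSmallCat (cData hS).le)
    (p : (cData hS).Obj) (a : S) (hp) : h.lres p a hp = p.1 * a := by
  rw [← h.dom_lres p a hp]
  exact (h.lres_le p a hp).1

theorem rres_eq_mul (hS : IsDRCRestriction S)
    (h : IsOrderedCat (cData hS).toSmallCat (cData hS).le)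
    (a : S) (q : (cData hS).Obj) (hq) : h.rres a q hq = a * q.1 := by
  rw [← h.cod_rres a q hq]
  exact congrArg unop (hS.naturalLE_op (h.rres_le a q hq)).1

theorem Theta_val (hS : IsDRCRestriction S) (h : IsWeakPOC (cData hS)) (a : S)
    (x : (cData hS).Obj) : (h.Theta a x).1 = ast (x.1 * a) := by
  refine (congrArg ast (hS.lres_eq_mul h.ordered _ a _)).trans ?_
  change ast (ast (x.1 * plus a) * a) = _
  rw [← hS.ast_congr, hS.mul_assoc, hS.plus_mul]

theorem Delta_val (hS : IsDRCRestriction S) (h : IsWeakPOC (cData hS)) (a : S)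
    (y : (cData hS).Obj) : (h.Delta a y).1 = plus (a * y.1) := by
  refine (congrArg plus (hS.rres_eq_mul h.ordered a _ _)).trans ?_
  change plus (a * plus (ast a * y.1)) = _
  rw [← hS.plus_congr, ← hS.mul_assoc, hS.mul_ast]

theorem isPOC (hS : IsDRCRestriction S) : IsPOC (cData hS) where
  toIsWeakPOC := hS.isWeakPOC
  times_Theta a p x := Subtype.ext <| by
    change plus ((hS.isWeakPOC.Theta a p).1 * x.1) = _
    rw [Theta_val, Theta_val]
    change _ = ast (plus (p.1 * (hS.isWeakPOC.Delta a x).1) * a)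
    rw [Delta_val]
    exact hS.plus_ast_mul_mul (hS.plus_obj p) a x.1
  star_Delta a p x := Subtype.ext <| by
    change ast (x.1 * (hS.isWeakPOC.Delta a p).1) = _
    rw [Delta_val, Delta_val]
    change _ = plus (a * ast ((hS.isWeakPOC.Theta a x).1 * p.1))
    rw [Theta_val]
    exact hS.ast_mul_plus_mul (hS.plus_obj p) a x.1

/-- The product `x p₁ ⋯ pₖ` of an element with a list of projections, bracketed to the left as in
the evaluation map of `cData`. -/
abbrev mulList (hS : IsDRCRestriction S) (x : S) (l : List (cData hS).Obj) : S :=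
  l.foldl (fun x q => x * q.1) x

theorem mulList_mul (hS : IsDRCRestriction S) (x y : S) (l : List (cData hS).Obj) :
    hS.mulList (x * y) l = x * hS.mulList y l :=
  List.foldl_hom (x * ·) fun _ _ => hS.mul_assoc _ _ _

theorem plus_mulList (hS : IsDRCRestriction S) (p : (cData hS).Obj) (l : List (cData hS).Obj)
    (h : List.IsChain (friendly (cData hS).times (cData hS).star) (p :: l)) :
    plus (hS.mulList p.1 l) = p.1 := by
  induction l generalizing p with
  | nil => exact hS.plus_obj p
  | cons q l ih =>
    obtain ⟨hpq, hql⟩ := List.isChain_cons_cons.1 h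
    calc plus (hS.mulList (p.1 * q.1) l) = plus (p.1 * q.1) := by
          rw [mulList_mul, hS.plus_congr, ih q hql]
      _ = p.1 := (congrArg Subtype.val hpq.1).symm

theorem ast_mulList (hS : IsDRCRestriction S) {x : S} {p : (cData hS).Obj}
    {l : List (cData hS).Obj} (hx : ast x = p.1)
    (h : List.IsChain (friendly (cData hS).times (cData hS).star) (p :: l)) :
    ast (hS.mulList x l) = ((p :: l).getLast (List.cons_ne_nil _ _)).1 := by
  induction l generalizing p x with
  | nil => exact hx
  | cons q l ih =>
    obtain ⟨hpq, hql⟩ := List.isChain_cons_cons.1 h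
    rw [List.getLast_cons_cons]
    refine ih (x := x * q.1) ?_ hql
    rw [hS.ast_congr, hx]
    exact (congrArg Subtype.val hpq.2).symm

theorem mulList_restrictTail (hS : IsDRCRestriction S) {x : S} {r : (cData hS).Obj}
    (hx : x * r.1 = x) (l : List (cData hS).Obj) :
    hS.mulList x (PPath.restrictTail (cData hS).star r l) = hS.mulList x l := by
  induction l generalizing x r with
  | nil => rfl
  | cons q l ih =>
    have hxq : x * ((cData hS).star r q).1 = x * q.1 :=
      calc x * ast (r.1 * q.1) = x * (r.1 * ast (r.1 * q.1)) := by rw [← hS.mul_assoc, hx]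
        _ = x * q.1 := by
          rw [hS.mul_ast_mul_proj (hS.plus_obj q), ← hS.mul_assoc, hx]
    refine (congrArg (fun y => hS.mulList y _) hxq).trans (ih ?_)
    rw [← hxq, hS.mul_assoc, hS.mul_self_of_plus_eq (hS.plus_obj _)]

theorem isEvaluation (hS : IsDRCRestriction S) : IsEvaluation (cData hS) where
  E1_single _ := rfl
  E1_pair p _ := hS.mul_self_of_plus_eq (hS.plus_obj p)
  E2_dom p := hS.plus_mulList p.head p.tail p.chain
  E2_cod p := hS.ast_mulList (hS.ast_obj _) p.chain
  E3 p q h := by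
    change (p.tail ++ q.tail).foldl (fun x q => x * q.1) p.head.1 =
      hS.mulList p.head.1 p.tail * hS.mulList q.head.1 q.tail
    rw [List.foldl_append, ← mulList_mul, ← h, PPath.last,
      ← hS.ast_mulList (hS.ast_obj _) p.chain, hS.mul_ast]
  E4 p q h := by
    obtain ⟨r, hr, hhead, htail⟩ := h
    have hle := (hS.naturalLE_iff_projLE (hS.plus_obj r) (hS.plus_obj q.head)).2
      (congrArg Subtype.val hr)
    change naturalLE (hS.mulList p.head.1 p.tail) (hS.mulList q.head.1 q.tail)
    rw [naturalLE, hS.plus_mulList _ _ p.chain, hS.plus_mulList _ _ q.chain, hhead, htail,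
      hS.mulList_restrictTail (hS.mul_self_of_plus_eq (hS.plus_obj r)), ← mulList_mul]
    obtain ⟨hmul, hplus⟩ := hle
    rw [hS.plus_obj] at hmul hplus
    rw [← hmul]
    exact ⟨rfl, by rwa [hS.plus_obj] at hplus⟩

theorem lam_eq_mul (hS : IsDRCRestriction S) {b : S} {e f : (cData hS).Obj}
    (l : hS.isPOC.Linked b e f) : hS.isPOC.lam hS.isEvaluation l = e.1 * b * f.1 := by
  change e.1 * ast (e.1 * plus b) * hS.isPOC.ordered.lres _ b _ *
    ((hS.isPOC.Theta b e).1 * f.1) = _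
  rw [Theta_val, lres_eq_mul]
  change e.1 * ast (e.1 * plus b) * (ast (e.1 * plus b) * b) * (ast (e.1 * b) * f.1) = _
  rw [hS.mul_ast_mul_proj (hS.plus_plus b), ← hS.mul_assoc (e.1 * plus b), hS.mul_ast,
    hS.mul_assoc e.1, hS.plus_mul, ← hS.mul_assoc, hS.mul_ast]

theorem rho_eq_mul (hS : IsDRCRestriction S) {b : S} {e f : (cData hS).Obj}
    (l : hS.isPOC.Linked b e f) : hS.isPOC.rho hS.isEvaluation l = e.1 * b * f.1 := by
  change e.1 * (hS.isPOC.Delta b f).1 * hS.isPOC.ordered.rres b _ _ *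
    (plus (ast b * f.1) * f.1) = _
  rw [Delta_val, rres_eq_mul]
  change e.1 * plus (b * f.1) * (b * plus (ast b * f.1)) * (plus (ast b * f.1) * f.1) = _
  rw [hS.plus_proj_mul_mul (hS.plus_ast b), hS.mul_assoc, hS.mul_assoc b, hS.plus_mul,
    ← hS.mul_assoc b, hS.mul_ast, hS.mul_assoc, hS.plus_mul, ← hS.mul_assoc]

theorem isCPOC (hS : IsDRCRestriction S) : IsCPOC (cData hS) where
  toIsPOC := hS.isPOC
  evaluation := hS.isEvaluation
  G2 _ _ _ l := (hS.lam_eq_mul l).trans (hS.rho_eq_mul l).symm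

theorem pseudoProduct_eq_mul (hS : IsDRCRestriction S) (h : IsCPOC (cData hS)) (a b : S) :
    pseudoProduct h a b = a * b := by
  change h.ordered.rres a _ _ * (plus (ast a * plus b) * ast (ast a * plus b)) *
    h.ordered.lres _ b _ = _
  rw [rres_eq_mul, lres_eq_mul, hS.plus_proj_mul_ast_proj (hS.plus_ast a) (hS.plus_plus b)]
  change a * plus (ast a * plus b) * (ast a * plus b) * (ast (ast a * plus b) * b) = _
  rw [hS.mul_assoc a, hS.plus_mul, ← hS.mul_assoc, hS.mul_assoc a, hS.mul_ast, hS.mul_assoc,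
    hS.mul_assoc, hS.plus_mul, ← hS.mul_assoc, hS.mul_ast]

end IsDRCRestriction

theorem IsBiUnaryHom.isCPOFunctor {S : Type u} {T : Type v} [BiUnary S] [BiUnary T] {φ : S → T}
    (hφ : IsBiUnaryHom φ) (hS : IsDRCRestriction S) (hT : IsDRCRestriction T) :
    IsCPOFunctor (cData hS) (cData hT) φ where
  F1_dom a := (hφ.map_plus a).symm
  F1_cod a := (hφ.map_ast a).symm
  F2 a b _ := hφ.map_mul a b
  F3 a b h := by
    refine ⟨?_, ?_⟩
    · rw [← hφ.map_plus, ← hφ.map_mul, ← h.1]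
    · rw [← hφ.map_plus, ← hφ.map_plus, ← hφ.map_mul, ← hφ.map_mul, h.2]
  F4_times e f := Subtype.ext ((hφ.map_plus _).trans (congrArg plus (hφ.map_mul _ _)))
  F4_star e f := Subtype.ext ((hφ.map_ast _).trans (congrArg ast (hφ.map_mul _ _)))
  F5 p := by
    change φ (hS.mulList p.head.1 p.tail) = hT.mulList (φ p.head.1) (p.tail.map _)
    exact (List.foldl_hom φ fun x q => (hφ.map_mul x q.1).symm).symm.trans List.foldl_map.symm

/-! ### Chain projection ordered categories -/

namespace SmallCat

variable {C : Type u} (K : SmallCat C)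

theorem comp_congr {a a' b b' : C} (ha : a = a') (hb : b = b') (h : K.cod a = K.dom b)
    (h' : K.cod a' = K.dom b') : K.comp a b h = K.comp a' b' h' := by
  subst ha hb
  rfl

theorem dom_dom (a : C) : K.dom (K.dom a) = K.dom a := by
  simpa only [K.cod_dom] using (K.dom_cod (K.dom a)).symm

theorem dom_obj (p : K.Obj) : K.dom p = p := by
  obtain ⟨_, x, rfl⟩ := p
  exact K.dom_dom x

theorem cod_obj (p : K.Obj) : K.cod p = p := by
  obtain ⟨_, x, rfl⟩ := p
  exact K.cod_dom x

theorem domObj_obj (p : K.Obj) : K.domObj p = p := Subtype.ext (K.dom_obj p)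

theorem codObj_obj (p : K.Obj) : K.codObj p = p := Subtype.ext (K.cod_obj p)

theorem comp_eq_left {a b : C} (h : K.cod a = K.dom b) (hb : b = K.cod a) : K.comp a b h = a :=
  (K.comp_congr rfl hb h (K.dom_cod a)).trans (K.comp_id a)

theorem comp_eq_right {a b : C} (h : K.cod a = K.dom b) (ha : a = K.dom b) : K.comp a b h = b :=
  (K.comp_congr ha rfl h (K.cod_dom b)).trans (K.id_comp b)

theorem comp_assoc {a b c : C} (h : K.cod a = K.dom b) (k : K.cod (K.comp a b h) = K.dom c) :
    K.comp (K.comp a b h) c k = K.comp a (K.comp b c ((K.cod_comp a b h).symm.trans k))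
      (h.trans (K.dom_comp b c _).symm) :=
  K.assoc a b c h _

theorem comp_comp_comp_comp {a b c d e : C} (hab : K.cod a = K.dom b) (hbc : K.cod b = K.dom c)
    (hcd h₁ h₂ h₃ h₄ h₅) :
    K.comp (K.comp a b hab) (K.comp (K.comp c d hcd) e h₁) h₂ =
      K.comp (K.comp a (K.comp (K.comp b c hbc) d h₃) h₄) e h₅ := by
  simp only [comp_assoc]

end SmallCat

namespace IsStrongProjAlg

variable {P : Type u} {times star : P → P → P}

theorem friendly_self (h : IsStrongProjAlg times star) (e : P) : friendly times star e e :=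
  ⟨(h.L1 e).symm, (h.R1 e).symm⟩

theorem times_le_times_right (h : IsStrongProjAlg times star) (e : P) {f g : P}
    (hfg : projLE times f g) : projLE times (times e f) (times e g) := by
  rw [hfg, h.L3]
  exact h.times_le _ _

theorem star_star_of_le (h : IsStrongProjAlg times star) {e f : P} (hef : projLE times e f)
    (g : P) : star e (star f g) = star e g := by
  have := h.R3 g f e
  rw [h.star_eq_of_le hef] at this
  exact this.symm

end IsStrongProjAlg

namespace IsOrderedCat

variable {C : Type u} {K : SmallCat C} {le : C → C → Prop}

theorem eq_of_dom_eq (h : IsOrderedCat K le) {u v a : C} (hu : le u a) (hv : le v a)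
    (huv : K.dom u = K.dom v) : u = v :=
  (h.O3 a (K.domObj u) (h.O1_dom _ _ hu)).unique ⟨hu, rfl⟩ ⟨hv, huv.symm⟩

theorem eq_of_cod_eq (h : IsOrderedCat K le) {u v a : C} (hu : le u a) (hv : le v a)
    (huv : K.cod u = K.cod v) : u = v :=
  (h.O4 a (K.codObj u) (h.O1_cod _ _ hu)).unique ⟨hu, rfl⟩ ⟨hv, huv.symm⟩

theorem le_of_dom_le (h : IsOrderedCat K le) {u v a : C} (hu : le u a) (hv : le v a)
    (huv : le (K.dom u) (K.dom v)) : le u v := by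
  have hres := h.lres_le (K.domObj u) v huv
  rwa [← h.eq_of_dom_eq hu (h.trans _ _ _ hres hv) (h.dom_lres (K.domObj u) v huv).symm] at hres

theorem le_of_cod_le (h : IsOrderedCat K le) {u v a : C} (hu : le u a) (hv : le v a)
    (huv : le (K.cod u) (K.cod v)) : le u v := by
  have hres := h.rres_le v (K.codObj u) huv
  rwa [← h.eq_of_cod_eq hu (h.trans _ _ _ hres hv) (h.cod_rres v (K.codObj u) huv).symm] at hres

theorem codObj_eq_domObj_of_le_obj (h : IsOrderedCat K le) {u : C} {p : K.Obj} (hu : le u p) :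
    K.codObj u = K.domObj u := by
  have hdom : K.dom u = u := by
    have hle := h.O1_dom _ _ hu
    rw [K.dom_obj] at hle
    exact h.eq_of_dom_eq hle hu (K.dom_obj (K.domObj u))
  exact Subtype.ext ((congrArg K.cod hdom).symm.trans (K.cod_dom u))

end IsOrderedCat

namespace IsWeakPOC

variable {C : Type u} {D : CPOData C}

theorem domObj_le (h : IsWeakPOC D) {a b : C} (hab : D.le a b) :
    projLE D.times (D.domObj a) (D.domObj b) :=
  (h.le_iff _ _).1 (h.ordered.O1_dom _ _ hab)

theorem codObj_le (h : IsWeakPOC D) {a b : C} (hab : D.le a b) :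
    projLE D.times (D.codObj a) (D.codObj b) :=
  (h.le_iff _ _).1 (h.ordered.O1_cod _ _ hab)

theorem le_of_domObj_le (h : IsWeakPOC D) {u v a : C} (hu : D.le u a) (hv : D.le v a)
    (huv : projLE D.times (D.domObj u) (D.domObj v)) : D.le u v :=
  h.ordered.le_of_dom_le hu hv ((h.le_iff _ _).2 huv)

theorem le_of_codObj_le (h : IsWeakPOC D) {u v a : C} (hu : D.le u a) (hv : D.le v a)
    (huv : projLE D.times (D.codObj u) (D.codObj v)) : D.le u v :=
  h.ordered.le_of_cod_le hu hv ((h.le_iff _ _).2 huv)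

/-- The left restriction of `a` to `x ⋆ d(a)`, whose codomain is `x Θ_a`. -/
noncomputable abbrev lresStar (h : IsWeakPOC D) (x : D.Obj) (a : C) : C :=
  h.ordered.lres (D.star x (D.domObj a)) a (h.star_dom_le x a)

/-- The right restriction of `a` to `r(a) × y`, whose domain is `y Δ_a`. -/
noncomputable abbrev rresTimes (h : IsWeakPOC D) (a : C) (y : D.Obj) : C :=
  h.ordered.rres a (D.times (D.codObj a) y) (h.cod_times_le a y)

theorem lresStar_le (h : IsWeakPOC D) (x : D.Obj) (a : C) : D.le (h.lresStar x a) a :=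
  h.ordered.lres_le _ _ _

theorem rresTimes_le (h : IsWeakPOC D) (a : C) (y : D.Obj) : D.le (h.rresTimes a y) a :=
  h.ordered.rres_le _ _ _

theorem domObj_lresStar (h : IsWeakPOC D) (x : D.Obj) (a : C) :
    D.domObj (h.lresStar x a) = D.star x (D.domObj a) :=
  Subtype.ext (h.ordered.dom_lres _ _ _)

theorem codObj_rresTimes (h : IsWeakPOC D) (a : C) (y : D.Obj) :
    D.codObj (h.rresTimes a y) = D.times (D.codObj a) y :=
  Subtype.ext (h.ordered.cod_rres _ _ _)

theorem Theta_obj (h : IsWeakPOC D) (p x : D.Obj) : h.Theta p x = D.star x p := by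
  have hobj : h.Theta p x = D.domObj (h.lresStar x p) :=
    h.ordered.codObj_eq_domObj_of_le_obj (h.lresStar_le x p)
  rw [hobj, domObj_lresStar, D.domObj_obj]

theorem Delta_obj (h : IsWeakPOC D) (p y : D.Obj) : h.Delta p y = D.times p y := by
  have hobj : D.codObj (h.rresTimes p y) = h.Delta p y :=
    h.ordered.codObj_eq_domObj_of_le_obj (h.rresTimes_le p y)
  rw [← hobj, codObj_rresTimes, D.codObj_obj]

end IsWeakPOC

namespace IsEvaluation

variable {C : Type u} {D : CPOData C}

/-- The composite `u ∘ ε(r(u), d(v)) ∘ v` of two arrows with `r(u) 𝓕 d(v)`. -/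
def bridge (hε : IsEvaluation D) (u v : C)
    (h : friendly D.times D.star (D.codObj u) (D.domObj v)) : C :=
  D.comp (D.comp u (D.eval (PPath.pair _ _ h)) (hε.dom_pair h).symm) v
    ((D.cod_comp _ _ _).trans (hε.cod_pair h))

theorem bridge_eq (hε : IsEvaluation D) {u v : C} {e f : D.Obj} (he : D.codObj u = e)
    (hf : D.domObj v = f) (hef : friendly D.times D.star e f) (h) :
    hε.bridge u v h = D.comp
      (D.comp u (D.eval (PPath.pair e f hef))
        ((congrArg Subtype.val he).trans (hε.dom_pair hef).symm))
      v ((D.cod_comp _ _ _).trans ((hε.cod_pair hef).trans (congrArg Subtype.val hf).symm)) := by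
  subst he hf
  rfl

theorem domObj_bridge (hε : IsEvaluation D) {u v : C} (h) :
    D.domObj (hε.bridge u v h) = D.domObj u :=
  Subtype.ext ((D.dom_comp _ _ _).trans (D.dom_comp _ _ _))

theorem codObj_bridge (hε : IsEvaluation D) {u v : C} (h) :
    D.codObj (hε.bridge u v h) = D.codObj v :=
  Subtype.ext (D.cod_comp _ _ _)

theorem bridge_eq_comp (hε : IsEvaluation D) {u v : C} (h) (huv : D.cod u = D.dom v) :
    hε.bridge u v h = D.comp u v huv := by
  have hobj : D.domObj v = D.codObj u := Subtype.ext huv.symm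
  rw [hε.bridge_eq rfl hobj (hobj ▸ h)]
  exact D.comp_congr (D.comp_eq_left _ (hε.E1_pair (D.codObj u) _)) rfl _ _

theorem bridge_obj (hε : IsEvaluation D) {u : C} {q : D.Obj}
    (h : friendly D.times D.star (D.codObj u) q) (h') :
    hε.bridge u q h' = D.comp u (D.eval (PPath.pair _ q h)) (hε.dom_pair h).symm := by
  rw [hε.bridge_eq rfl (D.domObj_obj q) h]
  exact D.comp_eq_left _ ((D.cod_comp _ _ _).trans (hε.cod_pair h)).symm

end IsEvaluation

namespace IsPOC

variable {C : Type u} {D : CPOData C}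

theorem linked_times_Delta_star_Theta (h : IsPOC D) (b : C) (p q : D.Obj) :
    h.Linked b (D.times p (h.Delta b q)) (D.star (h.Theta b p) q) := by
  constructor
  · rw [← h.times_Theta]
    exact (h.strong.friendly_times_star _ _).2
  · rw [← h.star_Delta]
    exact (h.strong.friendly_times_star _ _).1

theorem dom_lam (h : IsPOC D) (hε : IsEvaluation D) {b : C} {e f : D.Obj}
    (l : h.Linked b e f) : D.dom (h.lam hε l) = e :=
  (D.dom_comp _ _ _).trans ((D.dom_comp _ _ _).trans (hε.dom_pair _))

theorem cod_lam (h : IsPOC D) (hε : IsEvaluation D) {b : C} {e f : D.Obj}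
    (l : h.Linked b e f) : D.cod (h.lam hε l) = f :=
  (D.cod_comp _ _ _).trans (hε.cod_pair l.friendly_f₁)

theorem dom_rho (h : IsPOC D) (hε : IsEvaluation D) {b : C} {e f : D.Obj}
    (l : h.Linked b e f) : D.dom (h.rho hε l) = e :=
  (D.dom_comp _ _ _).trans ((D.dom_comp _ _ _).trans (hε.dom_pair _))

theorem cod_rho (h : IsPOC D) (hε : IsEvaluation D) {b : C} {e f : D.Obj}
    (l : h.Linked b e f) : D.cod (h.rho hε l) = f :=
  (D.cod_comp _ _ _).trans (hε.cod_pair l.friendly_f₂)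

theorem bridge_bridge_lresStar (h : IsPOC D) (hε : IsEvaluation D) {u b v : C}
    (l : h.Linked b (D.codObj u) (D.domObj v)) (h₁ h₂) :
    hε.bridge (hε.bridge u (h.lresStar (D.codObj u) b) h₁) v h₂ =
      D.comp (D.comp u (h.lam hε l) (h.dom_lam hε l).symm) v
        ((D.cod_comp _ _ _).trans (h.cod_lam hε l)) := by
  rw [hε.bridge_eq (hε.codObj_bridge h₁) rfl l.friendly_f₁]
  simp only [hε.bridge_eq rfl (h.domObj_lresStar _ b) l.friendly_e₁, IsPOC.lam, D.comp_assoc]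
  exact D.comp_assoc _ _

theorem bridge_rresTimes_bridge (h : IsPOC D) (hε : IsEvaluation D) {u b v : C}
    (l : h.Linked b (D.codObj u) (D.domObj v)) (h₁ h₂) :
    hε.bridge u (hε.bridge (h.rresTimes b (D.domObj v)) v h₁) h₂ =
      D.comp (D.comp u (h.rho hε l) (h.dom_rho hε l).symm) v
        ((D.cod_comp _ _ _).trans (h.cod_rho hε l)) := by
  rw [hε.bridge_eq rfl (hε.domObj_bridge h₁) l.friendly_e₂]
  simp only [hε.bridge_eq (h.codObj_rresTimes b _) rfl l.friendly_f₂]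
  exact D.comp_comp_comp_comp _ (hε.cod_pair l.friendly_e₂) _ _ _ _ _ _

end IsPOC

namespace IsCPOC

variable {C : Type u} {D : CPOData C}

theorem bridge_assoc_of_linked (h : IsCPOC D) {u b v : C}
    (l : h.Linked b (D.codObj u) (D.domObj v)) (h₁ h₂ h₃ h₄) :
    h.evaluation.bridge (h.evaluation.bridge u (h.lresStar (D.codObj u) b) h₁) v h₂ =
      h.evaluation.bridge u (h.evaluation.bridge (h.rresTimes b (D.domObj v)) v h₃) h₄ := by
  rw [h.bridge_bridge_lresStar h.evaluation l, h.bridge_rresTimes_bridge h.evaluation l]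
  exact D.comp_congr (D.comp_congr rfl (h.G2 b _ _ l) _ _) rfl _ _

theorem pseudoProduct_eq_bridge (h : IsCPOC D) {a b u v : C} (hu : D.le u a) (hv : D.le v b)
    (hcod : D.codObj u = D.times (D.codObj a) (D.domObj b))
    (hdom : D.domObj v = D.star (D.codObj a) (D.domObj b)) (huv) :
    pseudoProduct h a b = h.evaluation.bridge u v huv := by
  have hu' : h.rresTimes a (D.domObj b) = u :=
    h.ordered.eq_of_cod_eq (h.rresTimes_le _ _) hu
      ((h.ordered.cod_rres _ _ _).trans (congrArg Subtype.val hcod.symm))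
  have hv' : h.lresStar (D.codObj a) b = v :=
    h.ordered.eq_of_dom_eq (h.lresStar_le _ _) hv
      ((h.ordered.dom_lres _ _ _).trans (congrArg Subtype.val hdom.symm))
  rw [h.evaluation.bridge_eq hcod hdom (h.strong.friendly_times_star _ _)]
  exact D.comp_congr (D.comp_congr hu' rfl _ _) hv' _ _

theorem pseudoProduct_eq_comp (h : IsCPOC D) {a b u v : C} (hu : D.le u a) (hv : D.le v b)
    (hcod : D.codObj u = D.times (D.codObj a) (D.domObj b))
    (hdom : D.domObj v = D.star (D.codObj a) (D.domObj b)) (huv : D.cod u = D.dom v) :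
    pseudoProduct h a b = D.comp u v huv := by
  have hobj : D.domObj v = D.codObj u := Subtype.ext huv.symm
  rw [h.pseudoProduct_eq_bridge hu hv hcod hdom (hobj ▸ h.strong.friendly_self _)]
  exact h.evaluation.bridge_eq_comp _ huv

theorem pseudoProduct_eq_comp_of_cod_eq_dom (h : IsCPOC D) {a b : C} (hab : D.cod a = D.dom b) :
    pseudoProduct h a b = D.comp a b hab := by
  have hobj : D.domObj b = D.codObj a := Subtype.ext hab.symm
  exact h.pseudoProduct_eq_comp (h.ordered.refl a) (h.ordered.refl b)
    (by rw [hobj, h.strong.L1]) (by rw [hobj, h.strong.R1]) hab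

theorem dom_pseudoProduct_of_le (h : IsCPOC D) {u a : C} (hu : D.le u a) :
    pseudoProduct h (D.dom u) a = u := by
  have hcod : D.codObj (D.dom u) = D.domObj u := D.codObj_obj (D.domObj u)
  have hle := h.domObj_le hu
  refine (h.pseudoProduct_eq_comp (h.ordered.refl _) hu ?_ ?_ (D.cod_dom u)).trans (D.id_comp u)
  · rw [hcod, h.strong.times_eq_of_le hle]
  · rw [hcod, h.strong.star_eq_of_le hle]

theorem pseudoProduct_cod_of_le (h : IsCPOC D) {u a : C} (hu : D.le u a) :
    pseudoProduct h a (D.cod u) = u := by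
  have hdom : D.domObj (D.cod u) = D.codObj u := D.domObj_obj (D.codObj u)
  have hle := h.codObj_le hu
  refine (h.pseudoProduct_eq_comp hu (h.ordered.refl _) ?_ ?_ (D.dom_cod u)).trans (D.comp_id u)
  · rw [hdom]
    exact hle
  · rw [hdom, h.strong.star_eq_of_le' hle]

theorem domObj_pseudoProduct (h : IsCPOC D) (a b : C) :
    D.domObj (pseudoProduct h a b) = h.Delta a (D.domObj b) :=
  Subtype.ext ((D.dom_comp _ _ _).trans (D.dom_comp _ _ _))

theorem codObj_pseudoProduct (h : IsCPOC D) (a b : C) :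
    D.codObj (pseudoProduct h a b) = h.Theta b (D.codObj a) :=
  Subtype.ext (D.cod_comp _ _ _)

theorem bridge_le_pseudoProduct (h : IsCPOC D) {a b u v : C} (hu : D.le u a) (hv : D.le v b)
    (hcod : projLE D.times (D.codObj u) (D.times (D.codObj a) (D.domObj b)))
    (hdom : D.domObj v = D.star (D.codObj u) (D.domObj b)) (huv) :
    D.le (h.evaluation.bridge u v huv) (pseudoProduct h a b) := by
  have hstar : D.domObj v = D.star (D.codObj u) (D.star (D.codObj a) (D.domObj b)) := by
    rw [hdom, h.strong.star_star_of_le (h.codObj_le hu)]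
  refine h.ordered.O2 _ _ _ _ _ _ (h.ordered.O2 _ _ _ _ _ _ ?_ ?_) ?_
  · refine h.le_of_codObj_le hu (h.rresTimes_le a (D.domObj b)) ?_
    rwa [h.codObj_rresTimes]
  · exact h.evaluation.E4 _ _ ⟨D.codObj u, hcod, rfl, congrArg (fun f => [f]) hstar⟩
  · refine h.le_of_domObj_le hv (h.lresStar_le (D.codObj a) b) ?_
    rw [h.domObj_lresStar, hstar]
    exact h.strong.star_le _ _

theorem pseudoProduct_pseudoProduct_left (h : IsCPOC D) {a b c u v : C} (hu : D.le u a)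
    (hv : D.le v c) (hcod : D.codObj u = D.times (D.codObj a) (h.Delta b (D.domObj c)))
    (hdom : D.domObj v = D.star (h.Theta b (D.codObj a)) (D.domObj c)) (h₁ h₂) :
    pseudoProduct h (pseudoProduct h a b) c =
      h.evaluation.bridge (h.evaluation.bridge u (h.lresStar (D.codObj u) b) h₁) v h₂ := by
  have hTheta : h.Theta b (D.codObj u) = D.times (h.Theta b (D.codObj a)) (D.domObj c) := by
    rw [h.times_Theta, hcod]
  have hle : projLE D.times (D.codObj u) (D.times (D.codObj a) (D.domObj b)) := by
    rw [hcod]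
    exact h.strong.times_le_times_right _ (h.Delta_le _ _)
  refine h.pseudoProduct_eq_bridge
    (h.bridge_le_pseudoProduct hu (h.lresStar_le _ _) hle (h.domObj_lresStar _ _) h₁) hv ?_ ?_ h₂
  · rw [h.evaluation.codObj_bridge, h.codObj_pseudoProduct]
    exact hTheta
  · rw [h.codObj_pseudoProduct, hdom]

theorem pseudoProduct_pseudoProduct_right (h : IsCPOC D) {a b c u v : C} (hu : D.le u a)
    (hv : D.le v c) (hcod : D.codObj u = D.times (D.codObj a) (h.Delta b (D.domObj c)))
    (hdom : D.domObj v = D.star (h.Theta b (D.codObj a)) (D.domObj c)) (h₁ h₂) :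
    pseudoProduct h a (pseudoProduct h b c) =
      h.evaluation.bridge u (h.evaluation.bridge (h.rresTimes b (D.domObj v)) v h₁) h₂ := by
  have hDelta : h.Delta b (D.domObj v) = D.star (D.codObj a) (h.Delta b (D.domObj c)) := by
    rw [h.star_Delta, hdom]
  have hle : projLE D.times (D.times (D.codObj b) (D.domObj v))
      (D.times (D.codObj b) (D.domObj c)) :=
    h.strong.times_le_times_right _ (h.domObj_le hv)
  have hstar : D.domObj v = D.star (D.times (D.codObj b) (D.domObj v)) (D.domObj c) := by
    have hSP2 := h.strong.SP2 (D.domObj c) (D.codObj b) (h.Theta b (D.codObj a))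
    rw [h.strong.star_star_of_le (h.Theta_le _ _), ← hdom] at hSP2
    exact hSP2.symm
  refine h.pseudoProduct_eq_bridge hu
    (h.bridge_le_pseudoProduct (h.rresTimes_le _ _) hv ?_ ?_ h₁) ?_ ?_ h₂
  · rwa [h.codObj_rresTimes]
  · rwa [h.codObj_rresTimes]
  · rw [h.domObj_pseudoProduct, hcod]
  · rw [h.evaluation.domObj_bridge, h.domObj_pseudoProduct]
    exact hDelta

theorem pseudoProduct_assoc (h : IsCPOC D) (a b c : C) :
    pseudoProduct h (pseudoProduct h a b) c = pseudoProduct h a (pseudoProduct h b c) := by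
  let u := h.rresTimes a (h.Delta b (D.domObj c))
  let v := h.lresStar (h.Theta b (D.codObj a)) c
  have hu : D.le u a := h.rresTimes_le _ _
  have hv : D.le v c := h.lresStar_le _ _
  have hcod : D.codObj u = D.times (D.codObj a) (h.Delta b (D.domObj c)) :=
    h.codObj_rresTimes _ _
  have hdom : D.domObj v = D.star (h.Theta b (D.codObj a)) (D.domObj c) := h.domObj_lresStar _ _
  have l : h.Linked b (D.codObj u) (D.domObj v) := by
    rw [hcod, hdom]
    exact h.linked_times_Delta_star_Theta _ _ _
  have h₁ : friendly D.times D.star (D.codObj u) (D.domObj (h.lresStar (D.codObj u) b)) := by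
    rw [h.domObj_lresStar]
    exact l.friendly_e₁
  have h₂ : friendly D.times D.star (D.codObj (h.evaluation.bridge u _ h₁)) (D.domObj v) := by
    rw [h.evaluation.codObj_bridge]
    exact l.friendly_f₁
  have h₃ : friendly D.times D.star (D.codObj (h.rresTimes b (D.domObj v))) (D.domObj v) := by
    rw [h.codObj_rresTimes]
    exact l.friendly_f₂
  have h₄ : friendly D.times D.star (D.codObj u) (D.domObj (h.evaluation.bridge _ v h₃)) := by
    rw [h.evaluation.domObj_bridge]
    exact l.friendly_e₂
  rw [h.pseudoProduct_pseudoProduct_left hu hv hcod hdom h₁ h₂,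
    h.pseudoProduct_pseudoProduct_right hu hv hcod hdom h₃ h₄,
    h.bridge_assoc_of_linked l]

theorem dom_pseudoProduct_le (h : IsCPOC D) (a b : C) :
    D.le (D.dom (pseudoProduct h a b)) (D.dom a) := by
  rw [show D.dom (pseudoProduct h a b) = h.Delta a (D.domObj b) from
    congrArg Subtype.val (h.domObj_pseudoProduct a b)]
  exact (h.le_iff _ (D.domObj a)).2 (h.Delta_le _ _)

theorem cod_pseudoProduct_le (h : IsCPOC D) (a b : C) :
    D.le (D.cod (pseudoProduct h a b)) (D.cod b) := by
  rw [show D.cod (pseudoProduct h a b) = h.Theta b (D.codObj a) from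
    congrArg Subtype.val (h.codObj_pseudoProduct a b)]
  exact (h.le_iff _ (D.codObj b)).2 (h.Theta_le _ _)

theorem domObj_obj_pseudoProduct (h : IsCPOC D) (p : D.Obj) (y : C) :
    D.domObj (pseudoProduct h p y) = D.times p (D.domObj y) := by
  rw [h.domObj_pseudoProduct, h.Delta_obj]

theorem codObj_pseudoProduct_obj (h : IsCPOC D) (x : C) (p : D.Obj) :
    D.codObj (pseudoProduct h x p) = D.star (D.codObj x) p := by
  rw [h.codObj_pseudoProduct, h.Theta_obj]

theorem obj_conj_of_le (h : IsCPOC D) {g p : D.Obj} (hg : D.le g p) :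
    pseudoProduct h (pseudoProduct h p g) p = g := by
  have hright := h.pseudoProduct_cod_of_le hg
  have hleft := h.dom_pseudoProduct_of_le hg
  rw [D.cod_obj] at hright
  rw [D.dom_obj] at hleft
  rw [hright, hleft]

theorem isDRCSemigroup (h : IsCPOC D) : @IsDRCSemigroup C (sData h) :=
  letI := sData h
  { mul_assoc := h.pseudoProduct_assoc
    plus_mul := fun x => h.dom_pseudoProduct_of_le (h.ordered.refl x)
    mul_ast := fun x => h.pseudoProduct_cod_of_le (h.ordered.refl x)
    plus_congr := fun x y => congrArg Subtype.val <| by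
      change D.domObj (pseudoProduct h x y) = D.domObj (pseudoProduct h x (D.domObj y))
      rw [h.domObj_pseudoProduct, h.domObj_pseudoProduct, D.domObj_obj]
    ast_congr := fun x y => congrArg Subtype.val <| by
      change D.codObj (pseudoProduct h x y) = D.codObj (pseudoProduct h (D.codObj x) y)
      rw [h.codObj_pseudoProduct, h.codObj_pseudoProduct, D.codObj_obj]
    plus_reduced := fun x y => (h.obj_conj_of_le (g := D.domObj _) (p := D.domObj x)
      (h.dom_pseudoProduct_le x y)).symm
    ast_reduced := fun x y => (h.obj_conj_of_le (g := D.codObj _) (p := D.codObj y)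
      (h.cod_pseudoProduct_le x y)).symm
    plus_plus := D.dom_dom
    ast_ast := fun x => D.cod_obj (D.codObj x)
    ast_plus := D.cod_dom
    plus_ast := fun x => (D.dom_cod x).symm }

theorem ample_left (h : IsCPOC D) (x y : C) :
    pseudoProduct h x (D.cod (pseudoProduct h y x)) =
      pseudoProduct h (D.cod (pseudoProduct h y (D.dom x))) x := by
  have hcod : D.codObj (pseudoProduct h y x) = D.codObj (h.lresStar (D.codObj y) x) :=
    h.codObj_pseudoProduct y x
  have hdom : D.codObj (pseudoProduct h y (D.dom x)) = D.domObj (h.lresStar (D.codObj y) x) :=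
    (h.codObj_pseudoProduct_obj y (D.domObj x)).trans (h.domObj_lresStar _ _).symm
  calc pseudoProduct h x (D.codObj (pseudoProduct h y x))
      = h.lresStar (D.codObj y) x := by
        rw [hcod]
        exact h.pseudoProduct_cod_of_le (h.lresStar_le _ _)
    _ = pseudoProduct h (D.codObj (pseudoProduct h y (D.dom x))) x := by
        rw [hdom]
        exact (h.dom_pseudoProduct_of_le (h.lresStar_le _ _)).symm

theorem ample_right (h : IsCPOC D) (x y : C) :
    pseudoProduct h (D.dom (pseudoProduct h x y)) x =
      pseudoProduct h x (D.dom (pseudoProduct h (D.cod x) y)) := by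
  have hdom : D.domObj (pseudoProduct h x y) = D.domObj (h.rresTimes x (D.domObj y)) :=
    h.domObj_pseudoProduct x y
  have hcod : D.domObj (pseudoProduct h (D.cod x) y) = D.codObj (h.rresTimes x (D.domObj y)) :=
    (h.domObj_obj_pseudoProduct (D.codObj x) y).trans (h.codObj_rresTimes _ _).symm
  calc pseudoProduct h (D.domObj (pseudoProduct h x y)) x
      = h.rresTimes x (D.domObj y) := by
        rw [hdom]
        exact h.dom_pseudoProduct_of_le (h.rresTimes_le _ _)
    _ = pseudoProduct h x (D.domObj (pseudoProduct h (D.cod x) y)) := by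
        rw [hcod]
        exact (h.pseudoProduct_cod_of_le (h.rresTimes_le _ _)).symm

theorem isDRCRestriction (h : IsCPOC D) : @IsDRCRestriction C (sData h) :=
  letI := sData h
  { h.isDRCSemigroup with
    ample_left := h.ample_left
    ample_right := h.ample_right }

theorem naturalLE_iff_le (h : IsCPOC D) (a b : C) :
    @naturalLE C (sData h) a b ↔ D.le a b := by
  constructor
  · rintro ⟨hmul, hconj⟩
    change a = pseudoProduct h (D.dom a) b at hmul
    change pseudoProduct h (pseudoProduct h (D.dom b) (D.dom a)) (D.dom b) = D.dom a at hconj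
    have hle : D.le (D.domObj a) (D.dom b) := by
      have hdom := h.ordered.trans _ _ _
        (h.dom_pseudoProduct_le (pseudoProduct h (D.dom b) (D.dom a)) (D.dom b))
        (h.dom_pseudoProduct_le (D.dom b) (D.dom a))
      rwa [hconj, D.dom_dom, D.dom_dom] at hdom
    have hres := h.dom_pseudoProduct_of_le (h.ordered.lres_le _ b hle)
    rw [h.ordered.dom_lres] at hres
    rw [hmul.trans hres]
    exact h.ordered.lres_le _ b hle
  · intro hab
    exact ⟨(h.dom_pseudoProduct_of_le hab).symm,
      h.obj_conj_of_le (g := D.domObj a) (p := D.domObj b) (h.ordered.O1_dom _ _ hab)⟩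

theorem pseudoProduct_obj_of_friendly (h : IsCPOC D) {a : C} {p q : D.Obj} (hp : D.codObj a = p)
    (hpq : friendly D.times D.star p q) :
    pseudoProduct h a q = D.comp a (D.eval (PPath.pair p q hpq))
      ((congrArg Subtype.val hp).trans (h.evaluation.dom_pair hpq).symm) := by
  subst hp
  have hq : D.domObj q = q := D.domObj_obj q
  rw [h.pseudoProduct_eq_bridge (h.ordered.refl a) (h.ordered.refl _)
    (by rw [hq]; exact hpq.1) (by rw [hq]; exact hpq.2) (by rwa [hq])]
  exact h.evaluation.bridge_obj hpq _

theorem foldl_pseudoProduct (h : IsCPOC D) {x : C} (p : D.Obj) (l : List D.Obj)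
    (hl : List.IsChain (friendly D.times D.star) (p :: l)) (hx : D.cod x = p) :
    l.foldl (fun y q => pseudoProduct h y q.1) x =
      D.comp x (D.eval ⟨p, l, hl⟩) (hx.trans (h.evaluation.E2_dom ⟨p, l, hl⟩).symm) := by
  induction l generalizing x p with
  | nil =>
    exact (D.comp_eq_left _ ((h.evaluation.E1_single p).trans hx.symm)).symm
  | cons q l ih =>
    obtain ⟨hpq, hql⟩ := List.isChain_cons_cons.1 hl
    have hx' : D.codObj x = p := Subtype.ext hx
    rw [List.foldl_cons, h.pseudoProduct_obj_of_friendly hx' hpq]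
    refine (ih q hql ((D.cod_comp _ _ _).trans (h.evaluation.cod_pair hpq))).trans
      ((D.comp_assoc _ _).trans ?_)
    exact D.comp_congr rfl (h.evaluation.E3 (PPath.pair p q hpq) ⟨q, l, hql⟩ rfl).symm _ _

theorem foldl_pseudoProduct_eq_eval (h : IsCPOC D) (p : PPath D.times D.star) :
    p.tail.foldl (fun x q => pseudoProduct h x q.1) p.head.1 = D.eval p :=
  (h.foldl_pseudoProduct p.head p.tail p.chain (D.cod_obj _)).trans
    (D.comp_eq_right _ (h.evaluation.E2_dom p).symm)

end IsCPOC

namespace IsCPOFunctor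

variable {C : Type u} {C' : Type v} {D : CPOData C} {D' : CPOData C'} {φ : C → C'}

theorem mapObj_domObj (hφ : IsCPOFunctor D D' φ) (a : C) :
    mapObj φ hφ.F1_dom (D.domObj a) = D'.domObj (φ a) :=
  Subtype.ext (hφ.F1_dom a).symm

theorem mapObj_codObj (hφ : IsCPOFunctor D D' φ) (a : C) :
    mapObj φ hφ.F1_dom (D.codObj a) = D'.codObj (φ a) :=
  Subtype.ext (hφ.F1_cod a).symm

theorem map_bridge (hφ : IsCPOFunctor D D' φ) (hε : IsEvaluation D) (hε' : IsEvaluation D')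
    {u v : C} (h h') : φ (hε.bridge u v h) = hε'.bridge (φ u) (φ v) h' := by
  have hfriendly : friendly D'.times D'.star (mapObj φ hφ.F1_dom (D.codObj u))
      (mapObj φ hφ.F1_dom (D.domObj v)) := by
    rwa [hφ.mapObj_codObj, hφ.mapObj_domObj]
  rw [hε'.bridge_eq (hφ.mapObj_codObj u).symm (hφ.mapObj_domObj v).symm hfriendly]
  exact (hφ.F2 _ _ _).trans (D'.comp_congr
    ((hφ.F2 _ _ _).trans (D'.comp_congr rfl (hφ.F5 _) _ _)) rfl _ _)

theorem map_pseudoProduct (hφ : IsCPOFunctor D D' φ) (h : IsCPOC D) (h' : IsCPOC D') (a b : C) :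
    φ (pseudoProduct h a b) = pseudoProduct h' (φ a) (φ b) := by
  let u := h.rresTimes a (D.domObj b)
  let v := h.lresStar (D.codObj a) b
  have hcod : D'.codObj (φ u) = D'.times (D'.codObj (φ a)) (D'.domObj (φ b)) := by
    rw [← hφ.mapObj_codObj, h.codObj_rresTimes, hφ.F4_times, hφ.mapObj_codObj, hφ.mapObj_domObj]
  have hdom : D'.domObj (φ v) = D'.star (D'.codObj (φ a)) (D'.domObj (φ b)) := by
    rw [← hφ.mapObj_domObj, h.domObj_lresStar, hφ.F4_star, hφ.mapObj_codObj, hφ.mapObj_domObj]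
  have hfriendly : friendly D.times D.star (D.codObj u) (D.domObj v) := by
    rw [h.codObj_rresTimes, h.domObj_lresStar]
    exact h.strong.friendly_times_star _ _
  have hfriendly' : friendly D'.times D'.star (D'.codObj (φ u)) (D'.domObj (φ v)) := by
    rw [hcod, hdom]
    exact h'.strong.friendly_times_star _ _
  rw [h'.pseudoProduct_eq_bridge (hφ.F3 u a (h.rresTimes_le _ _)) (hφ.F3 v b (h.lresStar_le _ _))
    hcod hdom hfriendly', ← hφ.map_bridge h.evaluation h'.evaluation hfriendly,
    h.pseudoProduct_eq_bridge (h.rresTimes_le _ _) (h.lresStar_le _ _) (h.codObj_rresTimes _ _)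
      (h.domObj_lresStar _ _) hfriendly]

theorem isBiUnaryHom (hφ : IsCPOFunctor D D' φ) (h : IsCPOC D) (h' : IsCPOC D') :
    @IsBiUnaryHom C C' (sData h) (sData h') φ :=
  letI := sData h
  letI := sData h'
  { map_mul := hφ.map_pseudoProduct h h'
    map_plus := fun a => (hφ.F1_dom a).symm
    map_ast := fun a => (hφ.F1_cod a).symm }

end IsCPOFunctor

/-! ### The two constructions are mutually inverse -/

/-- The types of objects of `D₁` and `D₂` are only propositionally equal, so the operations on
objects and the evaluation maps are compared on underlying elements. -/
theorem CPOData.ext_of_val {C : Type u} {D₁ D₂ : CPOData C} (hdom : D₁.dom = D₂.dom)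
    (hcod : D₁.cod = D₂.cod) (hcomp : ∀ a b h₁ h₂, D₁.comp a b h₁ = D₂.comp a b h₂)
    (hle : ∀ a b, D₁.le a b ↔ D₂.le a b)
    (htimes : ∀ (e f : D₁.Obj) (e' f' : D₂.Obj), e.1 = e'.1 → f.1 = f'.1 →
      (D₁.times e f).1 = (D₂.times e' f').1)
    (hstar : ∀ (e f : D₁.Obj) (e' f' : D₂.Obj), e.1 = e'.1 → f.1 = f'.1 →
      (D₁.star e f).1 = (D₂.star e' f').1)
    (heval : ∀ (p : PPath D₁.times D₁.star) (q : PPath D₂.times D₂.star), p.head.1 = q.head.1 →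
      p.tail.map Subtype.val = q.tail.map Subtype.val → D₁.eval p = D₂.eval q) : D₁ = D₂ := by
  obtain ⟨⟨dom, cod, comp, _, _, _, _, _, _, _⟩, le, times, star, eval⟩ := D₁
  obtain ⟨⟨dom', cod', comp', _, _, _, _, _, _, _⟩, le', times', star', eval'⟩ := D₂
  dsimp only at hdom hcod hcomp hle
  subst hdom hcod
  obtain rfl : comp = comp' := funext fun a => funext fun b => funext fun h => hcomp a b h h
  obtain rfl : le = le' := funext fun a => funext fun b => propext (hle a b)
  obtain rfl : times = times' :=
    funext fun e => funext fun f => Subtype.ext (htimes e f e f rfl rfl)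
  obtain rfl : star = star' :=
    funext fun e => funext fun f => Subtype.ext (hstar e f e f rfl rfl)
  obtain rfl : eval = eval' := funext fun p => heval p p rfl rfl
  rfl

theorem cData_sData {C : Type u} {D : CPOData C} (h : IsCPOC D)
    (hS : @IsDRCRestriction C (sData h)) : @cData C (sData h) hS = D := by
  refine CPOData.ext_of_val rfl rfl
    (fun a b _ hab => h.pseudoProduct_eq_comp_of_cod_eq_dom hab) h.naturalLE_iff_le ?_ ?_ ?_
  · rintro ⟨e, _⟩ ⟨f, _⟩ e' f' rfl rfl
    exact congrArg Subtype.val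
      ((h.domObj_obj_pseudoProduct e' f').trans (congrArg _ (D.domObj_obj f')))
  · rintro ⟨e, _⟩ ⟨f, _⟩ e' f' rfl rfl
    exact congrArg Subtype.val
      ((h.codObj_pseudoProduct_obj e' f').trans (congrArg (D.star · f') (D.codObj_obj e')))
  · intro p q hhead htail
    calc p.tail.foldl (fun x e => pseudoProduct h x e.1) p.head.1
        = (p.tail.map Subtype.val).foldl (pseudoProduct h) p.head.1 := List.foldl_map.symm
      _ = (q.tail.map Subtype.val).foldl (pseudoProduct h) q.head.1 := by rw [hhead, htail]
      _ = q.tail.foldl (fun x e => pseudoProduct h x e.1) q.head.1 := List.foldl_map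
      _ = D.eval q := h.foldl_pseudoProduct_eq_eval q

theorem sData_cData {S : Type u} [op : BiUnary S] (hS : IsDRCRestriction S)
    (h : IsCPOC (cData hS)) : sData h = op := by
  have hmul : pseudoProduct h = fun a b => a * b :=
    funext fun a => funext fun b => hS.pseudoProduct_eq_mul h a b
  unfold sData
  rw [hmul]
  rfl

theorem DRS.mk_eq {S : Type u} {n : Nonempty S} {op₁ op₂ : BiUnary S} (h : op₁ = op₂) {i₁ i₂} :
    DRS.mk S n op₁ i₁ = DRS.mk S n op₂ i₂ := by
  subst h
  rfl

theorem DRS.hom_heq {S T : Type u} {nS : Nonempty S} {nT : Nonempty T} {op₁ op₂ : BiUnary S}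
    {op₁' op₂' : BiUnary T} (h : op₁ = op₂) (h' : op₁' = op₂') {i₁ i₂ j₁ j₂} {φ : S → T}
    {k₁ k₂} : HEq (DRS.Hom.mk (S := ⟨S, nS, op₁, i₁⟩) (T := ⟨T, nT, op₁', j₁⟩) φ k₁)
      (DRS.Hom.mk (S := ⟨S, nS, op₂, i₂⟩) (T := ⟨T, nT, op₂', j₂⟩) φ k₂) := by
  subst h h'
  rfl

theorem CPOC.mk_eq {C : Type u} {n : Nonempty C} {D₁ D₂ : CPOData C} (h : D₁ = D₂) {i₁ i₂} :
    CPOC.mk C n D₁ i₁ = CPOC.mk C n D₂ i₂ := by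
  subst h
  rfl

theorem CPOC.hom_heq {C C' : Type u} {nC : Nonempty C} {nC' : Nonempty C'} {D₁ D₂ : CPOData C}
    {D₁' D₂' : CPOData C'} (h : D₁ = D₂) (h' : D₁' = D₂') {i₁ i₂ j₁ j₂} {φ : C → C'}
    {k₁ k₂} : HEq (CPOC.Hom.mk (C₁ := ⟨C, nC, D₁, i₁⟩) (C₂ := ⟨C', nC', D₁', j₁⟩) φ k₁)
      (CPOC.Hom.mk (C₁ := ⟨C, nC, D₂, i₂⟩) (C₂ := ⟨C', nC', D₂', j₂⟩) φ k₂) := by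
  subst h h'
  rfl

theorem functorC_comp_functorS (hCobj hCmap hSobj hSmap) :
    functorC.{u} hCobj hCmap ⋙ functorS hSobj hSmap = 𝟭 DRS.{u} :=
  Functor.hext (fun S => DRS.mk_eq (sData_cData S.isDRCRestriction _))
    fun S T _ => DRS.hom_heq (sData_cData S.isDRCRestriction _)
      (sData_cData T.isDRCRestriction _)

theorem functorS_comp_functorC (hCobj hCmap hSobj hSmap) :
    functorS.{u} hSobj hSmap ⋙ functorC hCobj hCmap = 𝟭 CPOC.{u} :=
  Functor.hext (fun C => CPOC.mk_eq (cData_sData C.isCPOC _))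
    fun C C' _ => CPOC.hom_heq (cData_sData C.isCPOC _) (cData_sData C'.isCPOC _)

end DRC

theorem theorem6p8 :
    ∃ (hCobj : ∀ S : DRC.DRS.{u}, DRC.IsCPOC (DRC.cData S.isDRCRestriction))
      (hCmap : ∀ (S T : DRC.DRS.{u}) (f : S ⟶ T), DRC.IsCPOFunctor
        (DRC.cData S.isDRCRestriction) (DRC.cData T.isDRCRestriction) f.toFun)
      (hSobj : ∀ C : DRC.CPOC.{u},
        @DRC.IsDRCRestriction C.carrier (DRC.sData C.isCPOC))
      (hSmap : ∀ (C₁ C₂ : DRC.CPOC.{u}) (f : C₁ ⟶ C₂),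
        @DRC.IsBiUnaryHom C₁.carrier C₂.carrier
          (DRC.sData C₁.isCPOC) (DRC.sData C₂.isCPOC) f.toFun),
      DRC.functorC hCobj hCmap ⋙ DRC.functorS hSobj hSmap = 𝟭 DRC.DRS.{u} ∧
      DRC.functorS hSobj hSmap ⋙ DRC.functorC hCobj hCmap = 𝟭 DRC.CPOC.{u} :=
  ⟨fun S => S.isDRCRestriction.isCPOC,
    fun S T f => f.isHom.isCPOFunctor S.isDRCRestriction T.isDRCRestriction,
    fun C => C.isCPOC.isDRCRestriction,
    fun C₁ C₂ f => f.isFunctor.isBiUnaryHom C₁.isCPOC C₂.isCPOC,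
    DRC.functorC_comp_functorS _ _ _ _,
    DRC.functorS_comp_functorC _ _ _ _⟩
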